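/- Let $\Omega\subset\mathbb R^3$ be a bounded domain (open, connected) with smooth boundary, let $T>0$, $n\in\mathbb N$, and let $D_{ij}=D_{ji}>0$ ($i\neq j$, $1\le i,j\le n$) be given coefficients (the terms with $i=j$ in the sums below vanish, and the values $D_{ii}$ play no role). Let $c_i^0:\Omega\to\mathbb R$ satisfy $c_i^0\ge 0$ and $\sum_{i=1}^n c_i^0=1$ a.e. in $\Omega$. A vector $\boldsymbol c=(c_1,\dots,c_n)$ with $c_i\in L^2(0,T;H^1(\Omega))$ and $\partial_t c_i\in L^2(0,T;H^1(\Omega)^*)$ is called a weak solution of the Maxwell–Stefan system, with no-flux boundary conditions and initial data $\boldsymbol c^0$, if (i) for all $i$ and all $\varphi\in C^1_c(\overline\Omega\times(0,T))$, $$\int_0^T\!\!\int_\Omega c_i\,\partial_t\varphi\,dx\,dt+\int_0^T\!\!\int_\Omega \sqrt{c_i}\,m_i\cdot\nabla\varphi\,dx\,dt=0,$$ where $m=(m_1,\dots,m_n)$, $m_i:\Omega\times(0,T)\to\mathbb R^3$, solves a.e. in $\Omega\times(0,T)$ the linear system $$-\sum_{j=1}^nA_{ij}m_j=2\nabla\sqrt{c_i}\quad(1\le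 i\le n),\qquad \sum_{i=1}^n\sqrt{c_i}\,m_i=0,$$ with $A_{ij}=-\sqrt{c_ic_j}/D_{ij}$ for $i\ne j$ and $A_{ii}=\sum_{k\neq i}c_k/D_{ik}$; (ii) $c_i\in L^\infty(0,T;L^\infty(\Omega))$ for all $i$; (iii) $c_i\ge0$ for all $i$ and $\sum_{i=1}^n c_i=1$, a.e. in $\Omega\times[0,T]$; (iv) $\sqrt{c_i}\in L^2(0,T;H^1(\Omega))$ and $c_i\in C([0,T];L^2(\Omega))$, with $c_i(0)=c_i^0$ in $L^2(\Omega)$, for all $i$. The velocities $u_i$ are defined by $m_i=\sqrt{c_i}\,u_i$ where $c_i>0$; where $c_ic_j=0$ the expression $c_ic_j|u_i-u_j|^2$ is understood as $0$. Put $$H(\boldsymbol c)=\sum_{i=1}^n\int_\Omega c_i(\ln c_i-1)\,dx,\qquad 0\ln 0:=0 .$$ Then every weak solution $\boldsymbol c$ satisfies the entropy equality $$H(\boldsymbol c(t))+\frac12\sum_{i,j=1}^n\int_0^t\!\!\int_\Omega\frac{c_ic_j}{D_{ij}}\,|u_i-u_j|^2\,dx\,ds=H(\boldsymbol c^0)\qquad\text{for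 every }t\in(0,T],$$ all the integrals involved being integrals of integrable functions. -/

import Mathlib

open MeasureTheory Set Filter Topology
open scoped ContDiff ENNReal

namespace MaxwellStefan

noncomputable section

/-- Physical space `ℝ³` with its Euclidean norm. -/
abbrev Space : Type := EuclideanSpace ℝ (Fin 3)

/-- Bounded domains (open connected sets) of `ℝ³` with smooth boundary: near every boundary point
the set is the region `ρ < 0` for a smooth function `ρ` with nonvanishing derivative there. -/
structure IsBoundedSmoothDomain (Ω : Set Space) : Prop where
  isOpen : IsOpen Ω
  isConnected : IsConnected Ω
  isBounded : Bornology.IsBounded Ω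
  smooth_boundary : ∀ x₀ ∈ frontier Ω, ∃ (U : Set Space) (ρ : Space → ℝ),
    IsOpen U ∧ x₀ ∈ U ∧ ContDiffOn ℝ ∞ ρ U ∧ fderiv ℝ ρ x₀ ≠ 0 ∧
      ∀ x ∈ U, x ∈ Ω ↔ ρ x < 0

/-- `f ∈ H¹(Ω)` with weak gradient `g`. -/
structure HasH1Gradient (Ω : Set Space) (f : Space → ℝ) (g : Space → Space) : Prop where
  memLp : MemLp f 2 (volume.restrict Ω)
  memLp_gradient : MemLp g 2 (volume.restrict Ω)
  integral_eq : ∀ φ : Space → ℝ, ContDiff ℝ ∞ φ → HasCompactSupport φ → tsupport φ ⊆ Ω →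
    ∀ v : Space, ∫ x in Ω, f x * fderiv ℝ φ x v = -∫ x in Ω, inner ℝ (g x) v * φ x

theorem HasH1Gradient.congr {Ω : Set Space} {f f' : Space → ℝ} {g g' : Space → Space}
    (h : HasH1Gradient Ω f g) (hf : f =ᵐ[volume.restrict Ω] f')
    (hg : g =ᵐ[volume.restrict Ω] g') : HasH1Gradient Ω f' g' where
  memLp := (memLp_congr_ae hf).1 h.memLp
  memLp_gradient := (memLp_congr_ae hg).1 h.memLp_gradient
  integral_eq φ h₁ h₂ h₃ v := by
    have e₁ : ∫ x in Ω, f' x * fderiv ℝ φ x v = ∫ x in Ω, f x * fderiv ℝ φ x v := by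
      refine integral_congr_ae ?_
      filter_upwards [hf] with x hx
      rw [hx]
    have e₂ : ∫ x in Ω, inner ℝ (g' x) v * φ x = ∫ x in Ω, inner ℝ (g x) v * φ x := by
      refine integral_congr_ae ?_
      filter_upwards [hg] with x hx
      rw [hx]
    rw [e₁, e₂]
    exact h.integral_eq φ h₁ h₂ h₃ v

theorem integrable_mul_of_test {Ω : Set Space} {f φ : Space → ℝ}
    (hf : MemLp f 2 (volume.restrict Ω)) (hφ : Continuous φ) (hc : HasCompactSupport φ) :
    Integrable (fun x => f x * φ x) (volume.restrict Ω) :=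
  hf.integrable_mul (q := 2) ((hφ.memLp_of_hasCompactSupport hc).restrict Ω)

theorem integrable_mul_fderiv {Ω : Set Space} {f φ : Space → ℝ}
    (hf : MemLp f 2 (volume.restrict Ω)) (hφ : ContDiff ℝ ∞ φ) (hc : HasCompactSupport φ)
    (v : Space) : Integrable (fun x => f x * fderiv ℝ φ x v) (volume.restrict Ω) :=
  integrable_mul_of_test hf ((hφ.continuous_fderiv (by simp)).clm_apply continuous_const)
    (hc.fderiv_apply ℝ v)

theorem integrable_inner_mul {Ω : Set Space} {g : Space → Space} {φ : Space → ℝ}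
    (hg : MemLp g 2 (volume.restrict Ω)) (hφ : ContDiff ℝ ∞ φ) (hc : HasCompactSupport φ)
    (v : Space) : Integrable (fun x => inner ℝ (g x) v * φ x) (volume.restrict Ω) :=
  integrable_mul_of_test (hg.inner_const v) hφ.continuous hc

/-- The Sobolev space `H¹(Ω)`, realised as the space of pairs (function, weak gradient) with the
norm `(‖f‖² + ‖∇f‖²)^{1/2}`. -/
def H1 (Ω : Set Space) : Submodule ℝ
    (WithLp 2 (Lp ℝ 2 (volume.restrict Ω) × Lp Space 2 (volume.restrict Ω))) where
  carrier := {p | HasH1Gradient Ω p.fst p.snd}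
  zero_mem' := by
    have h : HasH1Gradient Ω (fun _ => (0 : ℝ)) (fun _ => (0 : Space)) :=
      ⟨MemLp.zero', MemLp.zero', by simp⟩
    exact h.congr (Lp.coeFn_zero ℝ 2 _).symm (Lp.coeFn_zero Space 2 _).symm
  add_mem' {p q} hp hq := by
    have h : HasH1Gradient Ω (fun x => p.fst x + q.fst x) (fun x => p.snd x + q.snd x) := by
      refine ⟨hp.memLp.add hq.memLp, hp.memLp_gradient.add hq.memLp_gradient,
        fun φ h₁ h₂ h₃ v => ?_⟩
      simp only [add_mul, inner_add_left]
      rw [integral_add (integrable_mul_fderiv hp.memLp h₁ h₂ v)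
          (integrable_mul_fderiv hq.memLp h₁ h₂ v),
        integral_add (integrable_inner_mul hp.memLp_gradient h₁ h₂ v)
          (integrable_inner_mul hq.memLp_gradient h₁ h₂ v),
        hp.integral_eq φ h₁ h₂ h₃ v, hq.integral_eq φ h₁ h₂ h₃ v]
      ring
    exact h.congr (Lp.coeFn_add p.fst q.fst).symm (Lp.coeFn_add p.snd q.snd).symm
  smul_mem' a p hp := by
    have h : HasH1Gradient Ω (fun x => a * p.fst x) (fun x => a • p.snd x) := by
      refine ⟨hp.memLp.const_mul a, hp.memLp_gradient.const_smul a, fun φ h₁ h₂ h₃ v => ?_⟩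
      simp only [mul_assoc, real_inner_smul_left]
      rw [integral_const_mul, integral_const_mul, hp.integral_eq φ h₁ h₂ h₃ v]
      ring
    exact h.congr (Lp.coeFn_smul a p.fst).symm (Lp.coeFn_smul a p.snd).symm

/-- Lebesgue measure on `(0,T) × Ω`; space-time points are written `(t, x)`. -/
def spaceTime (Ω : Set Space) (T : ℝ) : Measure (ℝ × Space) :=
  (volume.restrict (Ioo 0 T)).prod (volume.restrict Ω)

/-- `v ∈ L²(0,T;H¹(Ω))` with spatial weak gradient `G`. -/
structure HasL2H1Gradient (Ω : Set Space) (T : ℝ) (v : ℝ → Space → ℝ)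
    (G : ℝ → Space → Space) : Prop where
  memLp : MemLp (fun p : ℝ × Space => v p.1 p.2) 2 (spaceTime Ω T)
  memLp_gradient : MemLp (fun p : ℝ × Space => G p.1 p.2) 2 (spaceTime Ω T)
  ae_gradient : ∀ᵐ t ∂(volume.restrict (Ioo 0 T)), HasH1Gradient Ω (v t) (G t)

/-- `v ∈ L²(0,T;H¹(Ω))`. -/
def MemL2H1 (Ω : Set Space) (T : ℝ) (v : ℝ → Space → ℝ) : Prop :=
  ∃ G : ℝ → Space → Space, HasL2H1Gradient Ω T v G

/-- `∂ₜv ∈ L²(0,T;H¹(Ω)*)`: the distributional time derivative of `v`, with `L²(Ω)` embedded in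
`H¹(Ω)*` through the `L²(Ω)` inner product, is a square integrable `H¹(Ω)*`-valued function `F`. -/
def HasL2DualTimeDeriv (Ω : Set Space) (T : ℝ) (v : ℝ → Space → ℝ) : Prop :=
  ∃ F : ℝ → StrongDual ℝ (H1 Ω), MemLp F 2 (volume.restrict (Ioo 0 T)) ∧
    ∀ (ψ : H1 Ω) (θ : ℝ → ℝ), ContDiff ℝ ∞ θ → HasCompactSupport θ → tsupport θ ⊆ Ioo 0 T →
      ∫ t in Ioo 0 T, deriv θ t * ∫ x in Ω, v t x * ψ.1.fst x = -∫ t in Ioo 0 T, θ t * F t ψ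

/-- `v ∈ C([0,T];L²(Ω))`. -/
def ContinuousInL2 (Ω : Set Space) (T : ℝ) (v : ℝ → Space → ℝ) : Prop :=
  ∀ t ∈ Icc 0 T, MemLp (v t) 2 (volume.restrict Ω) ∧
    Tendsto (fun s => eLpNorm (fun x => v s x - v t x) 2 (volume.restrict Ω))
      (𝓝[Icc 0 T] t) (𝓝 0)

/-- The test functions `C¹_c(Ω̄ × (0,T))`: (restrictions to `Ω̄` of) `C¹` functions with compact
support in time inside the open interval `(0,T)`, and no condition on `∂Ω`. -/
structure IsTestFunction (T : ℝ) (φ : ℝ × Space → ℝ) : Prop where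
  contDiff : ContDiff ℝ 1 φ
  hasCompactSupport : HasCompactSupport φ
  tsupport_subset : tsupport φ ⊆ Ioo 0 T ×ˢ univ

/-- Admissible binary coefficients: positive and symmetric off the diagonal. The diagonal values
play no role. -/
structure IsDiffusivity {n : ℕ} (D : Fin n → Fin n → ℝ) : Prop where
  pos : ∀ i j, i ≠ j → 0 < D i j
  symm : ∀ i j, D i j = D j i

/-- The matrix `A` of the friction system, for concentrations `a`:
`A i j = -√(a i * a j) / D i j` off the diagonal and `A i i = ∑_{k ≠ i} a k / D i k`. -/
def frictionMatrix {n : ℕ} (D : Fin n → Fin n → ℝ) (a : Fin n → ℝ) : Matrix (Fin n) (Fin n) ℝ :=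
  fun i j => if i = j then ∑ k ∈ Finset.univ.erase i, a k / D i k else -√(a i * a j) / D i j

/-- `m` solves, almost everywhere in `(0,T) × Ω`, the linear system
`-∑ⱼ A i j mⱼ = 2 ∇√cᵢ` subject to the constraint `∑ᵢ √cᵢ mᵢ = 0`, where `∇√cᵢ ∈ L²` is the
weak gradient of `√cᵢ`. -/
def SolvesFrictionSystem {n : ℕ} (Ω : Set Space) (T : ℝ) (D : Fin n → Fin n → ℝ)
    (c : Fin n → ℝ → Space → ℝ) (m : Fin n → ℝ → Space → Space) : Prop :=
  ∃ G : Fin n → ℝ → Space → Space,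
    (∀ i, HasL2H1Gradient Ω T (fun t x => √(c i t x)) (G i)) ∧
    ∀ᵐ p ∂(spaceTime Ω T),
      (∀ i, -∑ j, frictionMatrix D (fun k => c k p.1 p.2) i j • m j p.1 p.2
        = (2 : ℝ) • G i p.1 p.2) ∧
      ∑ i, √(c i p.1 p.2) • m i p.1 p.2 = 0

/-- Weak solutions `c` of the Maxwell–Stefan system on `(0,T) × Ω` with no-flux boundary condition
and initial datum `c₀`; `m i = √cᵢ uᵢ` are the associated rescaled velocities. -/
structure IsWeakSolution {n : ℕ} (Ω : Set Space) (T : ℝ) (D : Fin n → Fin n → ℝ)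
    (c₀ : Fin n → Space → ℝ) (c : Fin n → ℝ → Space → ℝ) (m : Fin n → ℝ → Space → Space) :
    Prop where
  memL2H1 : ∀ i, MemL2H1 Ω T (c i)
  timeDeriv : ∀ i, HasL2DualTimeDeriv Ω T (c i)
  measurable_m : ∀ i,
    AEStronglyMeasurable (fun p : ℝ × Space => m i p.1 p.2) (spaceTime Ω T)
  friction : SolvesFrictionSystem Ω T D c m
  weak_form : ∀ (i : Fin n) (φ : ℝ × Space → ℝ), IsTestFunction T φ →
    (∫ t in Ioo 0 T, ∫ x in Ω, c i t x * deriv (fun s => φ (s, x)) t) +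
      (∫ t in Ioo 0 T, ∫ x in Ω,
        inner ℝ (√(c i t x) • m i t x) (gradient (fun y => φ (t, y)) x)) = 0
  bounded : ∀ i, MemLp (fun p : ℝ × Space => c i p.1 p.2) ∞ (spaceTime Ω T)
  nonneg : ∀ i, ∀ᵐ p ∂(spaceTime Ω T), 0 ≤ c i p.1 p.2
  sum_eq_one : ∀ᵐ p ∂(spaceTime Ω T), ∑ i, c i p.1 p.2 = 1
  sqrt_memL2H1 : ∀ i, MemL2H1 Ω T (fun t x => √(c i t x))
  continuousInL2 : ∀ i, ContinuousInL2 Ω T (c i)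
  initial : ∀ i, c i 0 =ᵐ[volume.restrict Ω] c₀ i

/-- The diffusional velocity `u = m / √a` of a component of concentration `a`. Where `a = 0` it has
no meaning and is set to `0`. -/
def velocity (a : ℝ) (m : Space) : Space := (√a)⁻¹ • m

/-- The dissipation density `(cᵢ cⱼ / D i j) |uᵢ - uⱼ|²`. -/
def dissipation {n : ℕ} (D : Fin n → Fin n → ℝ) (c : Fin n → ℝ → Space → ℝ)
    (m : Fin n → ℝ → Space → Space) (i j : Fin n) (t : ℝ) (x : Space) : ℝ :=
  c i t x * c j t x / D i j *
    ‖velocity (c i t x) (m i t x) - velocity (c j t x) (m j t x)‖ ^ 2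

/-- The entropy density `a (ln a - 1)`, equal to `0` at `a = 0`. -/
def entropyDensity (a : ℝ) : ℝ := a * (Real.log a - 1)

/-- The entropy `H(c) = ∑ᵢ ∫_Ω cᵢ (ln cᵢ - 1) dx`. -/
def entropy {n : ℕ} (Ω : Set Space) (c : Fin n → Space → ℝ) : ℝ :=
  ∑ i, ∫ x in Ω, entropyDensity (c i x)

end

end MaxwellStefan

namespace MaxwellStefan

/-! Formally one tests the equation of species `i` with `ln c_i` and sums over `i`. The flux term
then produces the sum of `2 m_i · ∇√c_i`, which the friction system turns into minus half the total
dissipation. Three points need care: `ln c_i` is singular where `c_i = 0`, the chain rule in time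
must hold at low regularity, and `m_i` is undetermined by `u_i` on vacuum.

The logarithm is replaced by `ln (1 + c_i / δ)`, a `C¹` function of `√c_i` with bounded derivative,
hence in `H¹` for almost every time (`IsC1Limit.comp`). It may be used as a test function because
`C¹` functions up to the boundary are dense in `H¹(Ω)` (`IsBoundedSmoothDomain.isC1Limit`). The flux
`√c_i m_i` is square integrable, since the friction matrix is coercive on the complement of `√c`
(`IsWeakSolution.memLp_velocity`).

The chain rule (`IsConserved.chain_rule`) rests on convexity. The supporting-line inequality between
times `t` and `t + τ`, integrated in `t`, bounds a differentiable function of `τ` from below by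
zero, with equality at `τ = 0`. As `τ` may have either sign, the derivative at `0` vanishes, and
this is the desired equality.

The result is a balance with integrand `c_i / (c_i + δ) · 2 m_i · ∇√c_i`. As `δ → 0` this tends to
the integrand restricted to `c_i > 0` (`tendsto_integral_div_add`). The `ln δ` terms of the
regularised entropies cancel because the concentrations sum to one (`sum_integral_regEntropy`). The
algebraic identity `sum_inner_eq_dissipation` then recognises the limit as the dissipation. -/

theorem eLpNorm_two_sq {α E : Type*} [MeasurableSpace α] [NormedAddCommGroup E] (f : α → E)
    (μ : Measure α) : eLpNorm f 2 μ ^ 2 = ∫⁻ x, ‖f x‖ₑ ^ 2 ∂μ := by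
  have h := eLpNorm_nnreal_pow_eq_lintegral (f := f) (p := 2) (μ := μ) (by norm_num)
  simpa using h

theorem pow_two_le_pow_two {a b : ℝ≥0∞} : a ^ 2 ≤ b ^ 2 ↔ a ≤ b :=
  ENNReal.pow_le_pow_left_iff (by norm_num)

/-! ### Translations and mollification in `L²`. -/

section Translation

variable {X E : Type*} [NormedAddCommGroup X] [NormedSpace ℝ X] [FiniteDimensional ℝ X]
  [MeasurableSpace X] [BorelSpace X] {μ : Measure X} [μ.IsAddHaarMeasure]
  [NormedAddCommGroup E]

theorem continuous_translate_toLp {f : X → E} (hf : MemLp f 2 μ) :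
    Continuous fun y : X => (hf.comp_measurePreserving (measurePreserving_add_left μ y)).toLp
      (f ∘ (y + ·)) := by
  have : Fact ((2 : ℝ≥0∞) ≠ ⊤) := ⟨by norm_num⟩
  have h : Continuous fun y : X => DomAddAct.mk y +ᵥ hf.toLp f :=
    (DomAddAct.continuous_mk).vadd continuous_const
  exact h

theorem tendsto_eLpNorm_translate {f : X → E} (hf : MemLp f 2 μ) :
    Tendsto (fun y => eLpNorm (fun x => f (x - y) - f x) 2 μ) (𝓝 0) (𝓝 0) := by
  have h := ((continuous_translate_toLp hf).comp continuous_neg).tendsto 0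
  rw [tendsto_iff_edist_tendsto_0] at h
  refine h.congr fun y => ?_
  simp only [Function.comp_apply]
  rw [Lp.edist_toLp_toLp]
  refine eLpNorm_congr_ae (Eventually.of_forall fun x => ?_)
  simp [sub_eq_neg_add]

end Translation

section Mollify

variable {X E : Type*} [NormedAddCommGroup X] [NormedSpace ℝ X] [FiniteDimensional ℝ X]
  [MeasurableSpace X] [BorelSpace X] {μ : Measure X} [μ.IsAddHaarMeasure]
  [NormedAddCommGroup E] [NormedSpace ℝ E] [CompleteSpace E]

open scoped Convolution

/-- Since `k` is a probability density, the error at `x` is an average of `f (x - y) - f x` over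
`y`. Its square is at most the average of the squares, and Tonelli reduces the claim to the
translates with `k y ≠ 0`. No centring of `k` is needed, so kernels supported away from the origin
are allowed. -/
theorem eLpNorm_convolution_sub_le {k : X → ℝ} (hk : Continuous k) (hkc : HasCompactSupport k)
    (hk0 : ∀ x, 0 ≤ k x) (hk1 : ∫ x, k x ∂μ = 1) {f : X → E} (hf : MemLp f 2 μ) {ε : ℝ≥0∞}
    (hε : ∀ y, k y ≠ 0 → eLpNorm (fun x => f (x - y) - f x) 2 μ ≤ ε) :
    eLpNorm (fun x => (k ⋆[ContinuousLinearMap.lsmul ℝ ℝ, μ] f) x - f x) 2 μ ≤ ε := by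
  set ν : Measure X := μ.withDensity fun y => ENNReal.ofReal (k y) with hν
  have hkm : Measurable fun y => ENNReal.ofReal (k y) := hk.measurable.ennreal_ofReal
  have hkint : Integrable k μ := hk.integrable_of_hasCompactSupport hkc
  have hkl : ∫⁻ y, ENNReal.ofReal (k y) ∂μ = 1 := by
    rw [← ofReal_integral_eq_lintegral_ofReal hkint (Eventually.of_forall hk0), hk1]
    simp
  have hνp : IsProbabilityMeasure ν := by
    constructor
    rw [hν, withDensity_apply _ MeasurableSet.univ, Measure.restrict_univ, hkl]
  have hfl : LocallyIntegrable f μ := hf.locallyIntegrable (by norm_num)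
  have hpt : ∀ x, (‖(k ⋆[ContinuousLinearMap.lsmul ℝ ℝ, μ] f) x - f x‖ₑ) ^ 2 ≤
      ∫⁻ y, ENNReal.ofReal (k y) * (‖f (x - y) - f x‖ₑ) ^ 2 ∂μ := by
    intro x
    have hex : Integrable (fun y => k y • f (x - y)) μ :=
      (hkc.convolutionExists_left (ContinuousLinearMap.lsmul ℝ ℝ) hk hfl x)
    have e1 : (k ⋆[ContinuousLinearMap.lsmul ℝ ℝ, μ] f) x - f x
        = ∫ y, k y • (f (x - y) - f x) ∂μ := by
      simp only [smul_sub]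
      rw [integral_sub hex (hkint.smul_const _), integral_smul_const, hk1, one_smul]
      rfl
    have hm : AEStronglyMeasurable (fun y => f (x - y) - f x) μ :=
      (hf.1.comp_quasiMeasurePreserving
        (quasiMeasurePreserving_sub_left μ x)).sub aestronglyMeasurable_const
    have hm' : AEStronglyMeasurable (fun y => f (x - y) - f x) ν :=
      hm.mono_ac (withDensity_absolutelyContinuous _ _)
    have e2 : ‖∫ y, k y • (f (x - y) - f x) ∂μ‖ₑ ≤ eLpNorm (fun y => f (x - y) - f x) 1 ν := by
      rw [eLpNorm_one_eq_lintegral_enorm, hν,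
        lintegral_withDensity_eq_lintegral_mul_non_measurable _ hkm
          (Eventually.of_forall fun _ => ENNReal.ofReal_lt_top)]
      refine (enorm_integral_le_lintegral_enorm _).trans (le_of_eq ?_)
      refine lintegral_congr fun y => ?_
      simp [enorm_smul, Real.enorm_eq_ofReal (hk0 y)]
    rw [e1]
    calc _ ≤ (eLpNorm (fun y => f (x - y) - f x) 2 ν) ^ 2 :=
          pow_two_le_pow_two.2 (e2.trans
            (eLpNorm_le_eLpNorm_of_exponent_le (by norm_num) hm'))
      _ = _ := by
          rw [eLpNorm_two_sq, hν, lintegral_withDensity_eq_lintegral_mul_non_measurable _ hkm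
            (Eventually.of_forall fun _ => ENNReal.ofReal_lt_top)]
          rfl
  have hmeas : AEMeasurable (Function.uncurry fun x y =>
      ENNReal.ofReal (k y) * (‖f (x - y) - f x‖ₑ) ^ 2) (μ.prod μ) := by
    refine (hkm.comp measurable_snd).aemeasurable.mul (AEMeasurable.pow_const ?_ 2)
    exact ((hf.1.comp_quasiMeasurePreserving (quasiMeasurePreserving_sub μ μ)).sub
      (hf.1.comp_fst)).enorm
  rw [← pow_two_le_pow_two, eLpNorm_two_sq]
  calc _ ≤ ∫⁻ x, ∫⁻ y, ENNReal.ofReal (k y) * (‖f (x - y) - f x‖ₑ) ^ 2 ∂μ ∂μ :=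
        lintegral_mono hpt
    _ = ∫⁻ y, ∫⁻ x, ENNReal.ofReal (k y) * (‖f (x - y) - f x‖ₑ) ^ 2 ∂μ ∂μ :=
        lintegral_lintegral_swap hmeas
    _ ≤ ∫⁻ y, ENNReal.ofReal (k y) * ε ^ 2 ∂μ := by
        refine lintegral_mono fun y => ?_
        dsimp only
        rw [lintegral_const_mul' _ _ ENNReal.ofReal_ne_top, ← eLpNorm_two_sq]
        by_cases hy : k y = 0
        · simp [hy]
        · gcongr
          exact hε y hy
    _ = ε ^ 2 := by
        rw [lintegral_mul_const _ hkm, hkl, one_mul]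

end Mollify

/-! ### Density in `H¹(Ω)` of functions that are `C¹` up to the boundary. -/

/-- At a boundary point, take `v` along which the defining function `ρ` strictly decreases. Nearby
base points and nearby directions keep the decrease, so short moves from `Ω` stay in `Ω`. -/
theorem IsBoundedSmoothDomain.exists_inward_cone {Ω : Set Space} (hΩ : IsBoundedSmoothDomain Ω)
    {x₀ : Space} (hx₀ : x₀ ∈ closure Ω) :
    ∃ (v : Space) (r κ ε₀ : ℝ), 0 < r ∧ 0 < κ ∧ 0 < ε₀ ∧ ∀ x ∈ Ω ∩ Metric.ball x₀ r,
      ∀ ε ∈ Ioo 0 ε₀, ∀ u : Space, ‖u‖ ≤ κ → x + ε • (v + u) ∈ Ω := by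
  by_cases hx : x₀ ∈ Ω
  · obtain ⟨r, hr, hsub⟩ := Metric.isOpen_iff.1 hΩ.isOpen x₀ hx
    refine ⟨0, r / 2, 1, r / 2, by positivity, one_pos, by positivity, ?_⟩
    rintro x ⟨-, hx⟩ ε ⟨hε, hε'⟩ u hu
    apply hsub
    rw [Metric.mem_ball] at hx ⊢
    have h1 : dist (x + ε • (0 + u)) x ≤ ε := by
      rw [dist_eq_norm]
      simp only [zero_add, add_sub_cancel_left, norm_smul, Real.norm_eq_abs, abs_of_pos hε]
      nlinarith
    linarith [dist_triangle (x + ε • (0 + u)) x x₀]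
  · have hfr : x₀ ∈ frontier Ω := by
      rw [frontier, hΩ.isOpen.interior_eq]; exact ⟨hx₀, hx⟩
    obtain ⟨U, ρ, hU, hxU, hρ, hd, hΩρ⟩ := hΩ.smooth_boundary x₀ hfr
    -- Strict differentiability is what is needed: the increment of `ρ` is estimated between two
    -- points near `x₀`, neither of which is `x₀`.
    have hstrict : HasStrictFDerivAt ρ (fderiv ℝ ρ x₀) x₀ :=
      (hρ.contDiffAt (hU.mem_nhds hxU)).hasStrictFDerivAt (by simp)
    set ℓ := fderiv ℝ ρ x₀
    obtain ⟨v, hv⟩ : ∃ v, ℓ v < 0 := by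
      by_contra! h
      apply hd
      ext y
      have h1 := h y
      have h2 := h (-y)
      simp only [map_neg] at h2
      simp only [zero_apply]
      linarith
    set a := -ℓ v with ha
    have ha0 : 0 < a := by linarith
    -- `κ` and `η` are chosen so that the perturbation `u` and the linearisation error each cost at
    -- most `a / 4` per unit of `ε`, against the gain `a`. The net decrease of `ρ` is at least `ε *
    -- a / 2`.
    set κ := a / (4 * (‖ℓ‖ + 1)) with hκ
    have hℓ := norm_nonneg ℓ
    have hκ0 : 0 < κ := by positivity
    have hκ1 : ‖ℓ‖ * κ ≤ a / 4 := by
      rw [hκ, mul_div_assoc', div_le_div_iff₀ (by positivity) (by norm_num)]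
      nlinarith
    set η := a / (4 * (‖v‖ + κ)) with hη
    have hvn := norm_nonneg v
    have hη0 : 0 < η := by positivity
    have hη1 : η * (‖v‖ + κ) = a / 4 := by
      rw [hη]; field_simp
    have hev := (hasStrictFDerivAt_iff_isLittleO.1 hstrict).def hη0
    rw [nhds_prod_eq] at hev
    obtain ⟨S, hS, hSS⟩ := Filter.eventually_prod_self_iff'.1 hev
    obtain ⟨r, hr, hsub⟩ := Metric.mem_nhds_iff.1 (inter_mem hS (hU.mem_nhds hxU))
    refine ⟨v, r / 2, κ, r / 2 / (‖v‖ + κ), by positivity, hκ0, by positivity, ?_⟩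
    rintro x ⟨hxΩ, hx⟩ ε ⟨hε, hε'⟩ u hu
    rw [Metric.mem_ball] at hx
    have hvu : ‖v + u‖ ≤ ‖v‖ + κ := (norm_add_le _ _).trans (by linarith)
    have hb : ε * (‖v‖ + κ) < r / 2 := by
      rwa [lt_div_iff₀ (by positivity)] at hε'
    have hx1 : x ∈ Metric.ball x₀ r := by rw [Metric.mem_ball]; linarith
    have hy1 : x + ε • (v + u) ∈ Metric.ball x₀ r := by
      rw [Metric.mem_ball]
      have h1 : dist (x + ε • (v + u)) x ≤ ε * (‖v‖ + κ) := by
        rw [dist_eq_norm]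
        simp only [add_sub_cancel_left, norm_smul, Real.norm_eq_abs, abs_of_pos hε]
        gcongr
      linarith [dist_triangle (x + ε • (v + u)) x x₀]
    have hest := hSS (x + ε • (v + u)) (hsub hy1).1 x (hsub hx1).1
    rw [(hΩρ _ (hsub hy1).2)]
    have hxneg := (hΩρ _ (hsub hx1).2).1 hxΩ
    simp only [add_sub_cancel_left, map_smul, map_add, norm_smul, Real.norm_eq_abs,
      abs_of_pos hε, smul_eq_mul] at hest
    have h2 := (abs_le.1 hest).2
    have h3 : ℓ u ≤ a / 4 := (le_abs_self _).trans ((ℓ.le_opNorm u).trans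
      ((mul_le_mul_of_nonneg_left hu hℓ).trans hκ1))
    have h4 : η * (ε * ‖v + u‖) ≤ ε * (a / 4) := by
      rw [← hη1]
      have := mul_le_mul_of_nonneg_left hvu (mul_pos hη0 hε).le
      linarith
    have h5 : ε * (ℓ v + ℓ u) ≤ ε * (-a + a / 4) :=
      mul_le_mul_of_nonneg_left (by linarith) hε.le
    have h6 : 0 < ε * a := mul_pos hε ha0
    linarith

/-- The pair `(w, G)` belongs to the closure in `L²(Ω)` of the pairs `(ψ, ∇ψ)`, where `ψ` is a
compactly supported `C¹` function on the whole space. -/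
structure IsC1Limit (Ω : Set Space) (w : Space → ℝ) (G : Space → Space) : Prop where
  memLp : MemLp w 2 (volume.restrict Ω)
  memLp_gradient : MemLp G 2 (volume.restrict Ω)
  approx : ∀ ε : ℝ≥0∞, ε ≠ 0 → ∃ ψ : Space → ℝ, ContDiff ℝ 1 ψ ∧ HasCompactSupport ψ ∧
    eLpNorm (fun x => ψ x - w x) 2 (volume.restrict Ω) ≤ ε ∧
    eLpNorm (fun x => gradient ψ x - G x) 2 (volume.restrict Ω) ≤ ε

theorem continuous_gradient {ψ : Space → ℝ} (h : ContDiff ℝ 1 ψ) : Continuous (gradient ψ) :=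
  (InnerProductSpace.toDual ℝ Space).symm.continuous.comp (h.continuous_fderiv (by norm_num))

theorem hasCompactSupport_gradient {ψ : Space → ℝ} (h : HasCompactSupport ψ) :
    HasCompactSupport (gradient ψ) :=
  (h.fderiv ℝ).comp_left (map_zero (InnerProductSpace.toDual ℝ Space).symm)

theorem memLp_of_test {E : Type*} [NormedAddCommGroup E] {ψ : Space → E} (h : Continuous ψ)
    (hc : HasCompactSupport ψ) (Ω : Set Space) : MemLp ψ 2 (volume.restrict Ω) :=
  (h.memLp_of_hasCompactSupport hc).restrict Ω

theorem gradient_add {ψ ψ' : Space → ℝ} {x : Space} (h : DifferentiableAt ℝ ψ x)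
    (h' : DifferentiableAt ℝ ψ' x) :
    gradient (fun y => ψ y + ψ' y) x = gradient ψ x + gradient ψ' x := by
  simp only [gradient]
  rw [fderiv_fun_add h h', map_add]

theorem IsC1Limit.zero (Ω : Set Space) : IsC1Limit Ω (fun _ => 0) (fun _ => 0) where
  memLp := MemLp.zero'
  memLp_gradient := MemLp.zero'
  approx ε _ := ⟨fun _ => 0, contDiff_const, HasCompactSupport.zero, by simp, by simp [gradient]⟩

theorem IsC1Limit.add {Ω : Set Space} {w w' : Space → ℝ} {G G' : Space → Space}
    (h : IsC1Limit Ω w G) (h' : IsC1Limit Ω w' G') :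
    IsC1Limit Ω (fun x => w x + w' x) (fun x => G x + G' x) where
  memLp := h.memLp.add h'.memLp
  memLp_gradient := h.memLp_gradient.add h'.memLp_gradient
  approx ε hε := by
    obtain ⟨ψ, h1, h2, h3, h4⟩ := h.approx (ε / 2) (by simpa using hε)
    obtain ⟨ψ', h1', h2', h3', h4'⟩ := h'.approx (ε / 2) (by simpa using hε)
    refine ⟨fun x => ψ x + ψ' x, h1.add h1', h2.add h2', ?_, ?_⟩
    · have e : (fun x => ψ x + ψ' x - (w x + w' x))
          = (fun x => ψ x - w x) + fun x => ψ' x - w' x := by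
        ext x; simp only [Pi.add_apply]; ring
      rw [e]
      refine (eLpNorm_add_le ((memLp_of_test h1.continuous h2 Ω).sub h.memLp).1
        ((memLp_of_test h1'.continuous h2' Ω).sub h'.memLp).1 (by norm_num)).trans ?_
      exact (add_le_add h3 h3').trans (ENNReal.add_halves ε).le
    · have e : (fun x => gradient (fun x => ψ x + ψ' x) x - (G x + G' x))
          = (fun x => gradient ψ x - G x) + fun x => gradient ψ' x - G' x := by
        ext1 x
        rw [gradient_add (h1.differentiable (by norm_num) x) (h1'.differentiable (by norm_num) x)]
        simp only [Pi.add_apply]; abel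
      rw [e]
      refine (eLpNorm_add_le ((memLp_of_test (continuous_gradient h1)
          (hasCompactSupport_gradient h2) Ω).sub h.memLp_gradient).1
        ((memLp_of_test (continuous_gradient h1')
          (hasCompactSupport_gradient h2') Ω).sub h'.memLp_gradient).1 (by norm_num)).trans ?_
      exact (add_le_add h4 h4').trans (ENNReal.add_halves ε).le

theorem IsC1Limit.sum {ι : Type*} {Ω : Set Space} (s : Finset ι) {w : ι → Space → ℝ}
    {G : ι → Space → Space} (h : ∀ i ∈ s, IsC1Limit Ω (w i) (G i)) :
    IsC1Limit Ω (fun x => ∑ i ∈ s, w i x) (fun x => ∑ i ∈ s, G i x) := by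
  classical
  induction s using Finset.induction_on with
  | empty => simpa using IsC1Limit.zero Ω
  | insert a s ha ih =>
    simp only [Finset.sum_insert ha]
    exact (h a (Finset.mem_insert_self a s)).add
      (ih fun i hi => h i (Finset.mem_insert_of_mem hi))

theorem IsC1Limit.congr {Ω : Set Space} {w w' : Space → ℝ} {G G' : Space → Space}
    (h : IsC1Limit Ω w G) (hw : w =ᵐ[volume.restrict Ω] w') (hG : G =ᵐ[volume.restrict Ω] G') :
    IsC1Limit Ω w' G' where
  memLp := (memLp_congr_ae hw).1 h.memLp
  memLp_gradient := (memLp_congr_ae hG).1 h.memLp_gradient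
  approx ε hε := by
    obtain ⟨ψ, h1, h2, h3, h4⟩ := h.approx ε hε
    refine ⟨ψ, h1, h2, ?_, ?_⟩
    · refine (eLpNorm_congr_ae ?_).le.trans h3
      filter_upwards [hw] with x hx
      rw [hx]
    · refine (eLpNorm_congr_ae ?_).le.trans h4
      filter_upwards [hG] with x hx
      rw [hx]
open scoped Convolution

theorem inner_gradient (ψ : Space → ℝ) (x v : Space) :
    inner ℝ (gradient ψ x) v = fderiv ℝ ψ x v := by
  simp [gradient]

/-- A smooth probability density concentrated near `-s • v`. -/
theorem exists_shifted_kernel (v : Space) {s κ : ℝ} (hs : 0 < s) (hκ : 0 < κ) :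
    ∃ k : Space → ℝ, ContDiff ℝ ∞ k ∧ HasCompactSupport k ∧ (∀ y, 0 ≤ k y) ∧ ∫ y, k y = 1 ∧
      ∀ y, k y ≠ 0 → ‖y + s • v‖ ≤ κ * s := by
  have hκs : 0 < κ * s := mul_pos hκ hs
  let b : ContDiffBump (0 : Space) := ⟨κ * s / 2, κ * s, by positivity, by linarith⟩
  refine ⟨fun y => b.normed volume (y + s • v),
    b.contDiff_normed.comp (contDiff_id.add contDiff_const), ?_, fun y => b.nonneg_normed _, ?_, ?_⟩
  · exact b.hasCompactSupport_normed.comp_homeomorph (Homeomorph.addRight (s • v))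
  · rw [integral_add_right_eq_self (fun y => b.normed volume y), b.integral_normed]
  · intro y hy
    have : y + s • v ∈ Function.support (b.normed volume) := hy
    rw [b.support_normed_eq, mem_ball_zero_iff] at this
    exact this.le

theorem fderiv_convolution_apply {k : Space → ℝ} (hk : ContDiff ℝ ∞ k) (hkc : HasCompactSupport k)
    {g : Space → ℝ} (hg : LocallyIntegrable g volume) (x v : Space) :
    fderiv ℝ (k ⋆[ContinuousLinearMap.lsmul ℝ ℝ, volume] g) x v =
      ∫ z, fderiv ℝ k (x - z) v * g z := by
  have hk1 : ContDiff ℝ 1 k := hk.of_le (by simp)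
  rw [(hkc.hasFDerivAt_convolution_left (ContinuousLinearMap.lsmul ℝ ℝ) hk1 hg x).fderiv,
    convolution, ContinuousLinearMap.integral_apply
      ((hkc.fderiv ℝ).convolutionExists_left _ (hk1.continuous_fderiv (by norm_num))
        hg x).integrable,
    ← integral_sub_left_eq_self _ _ x]
  simp

theorem inner_convolution {k : Space → ℝ} (hk : ContDiff ℝ ∞ k) (hkc : HasCompactSupport k)
    {H : Space → Space} (hH : LocallyIntegrable H volume) (x v : Space) :
    inner ℝ ((k ⋆[ContinuousLinearMap.lsmul ℝ ℝ, volume] H) x) v =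
      ∫ z, inner ℝ (H z) v * k (x - z) := by
  have hex : Integrable (fun t => k t • H (x - t)) :=
    hkc.convolutionExists_left (ContinuousLinearMap.lsmul ℝ ℝ) hk.continuous hH x
  have e : (k ⋆[ContinuousLinearMap.lsmul ℝ ℝ, volume] H) x = ∫ t, k t • H (x - t) := rfl
  rw [e, real_inner_comm, ← integral_inner hex, ← integral_sub_left_eq_self _ _ x]
  refine integral_congr_ae (Eventually.of_forall fun z => ?_)
  simp [inner_smul_right, real_inner_comm, mul_comm]

theorem memLp_mul_of_test {E : Type*} [NormedAddCommGroup E] [NormedSpace ℝ E] {Ω : Set Space}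
    {f : Space → ℝ} {χ : Space → E}
    (hf : MemLp f 2 (volume.restrict Ω)) (hχ : Continuous χ) (hc : HasCompactSupport χ) :
    MemLp (fun x => f x • χ x) 2 (volume.restrict Ω) :=
  MemLp.smul (p := 2) (q := ⊤) ((hχ.memLp_of_hasCompactSupport hc).restrict Ω) hf

theorem memLp_smul_of_test {E : Type*} [NormedAddCommGroup E] [NormedSpace ℝ E] {Ω : Set Space}
    {G : Space → E} {χ : Space → ℝ}
    (hG : MemLp G 2 (volume.restrict Ω)) (hχ : Continuous χ) (hc : HasCompactSupport χ) :
    MemLp (fun x => χ x • G x) 2 (volume.restrict Ω) :=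
  MemLp.smul (p := ⊤) (q := 2) hG ((hχ.memLp_of_hasCompactSupport hc).restrict Ω)

/-- The function `z ↦ χ z * k (x - z)` is an admissible test function for the weak gradient, because
its support lies in `Ω`. Hence the jump of the extension by zero across the boundary is not seen at
such an `x`. -/
theorem gradient_convolution_cutoff {Ω : Set Space} (hΩ : IsOpen Ω) {f : Space → ℝ}
    {G : Space → Space} (h : HasH1Gradient Ω f G) {χ k : Space → ℝ} (hχ : ContDiff ℝ ∞ χ)
    (hχc : HasCompactSupport χ) (hk : ContDiff ℝ ∞ k) (hkc : HasCompactSupport k) {x : Space}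
    (hsub : tsupport (fun z => χ z * k (x - z)) ⊆ Ω) :
    gradient (k ⋆[ContinuousLinearMap.lsmul ℝ ℝ, volume] Ω.indicator fun z => f z * χ z) x =
      (k ⋆[ContinuousLinearMap.lsmul ℝ ℝ, volume]
        Ω.indicator fun z => χ z • G z + f z • gradient χ z) x := by
  have hχ1 : ContDiff ℝ 1 χ := hχ.of_le (by simp)
  have hg : MemLp (Ω.indicator fun z => f z * χ z) 2 volume :=
    (memLp_indicator_iff_restrict hΩ.measurableSet).2
      (memLp_mul_of_test h.memLp hχ.continuous hχc)
  have hH : MemLp (Ω.indicator fun z => χ z • G z + f z • gradient χ z) 2 volume :=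
    (memLp_indicator_iff_restrict hΩ.measurableSet).2
      ((memLp_smul_of_test h.memLp_gradient hχ.continuous hχc).add
        (memLp_mul_of_test h.memLp (continuous_gradient hχ1) (hasCompactSupport_gradient hχc)))
  refine ext_inner_right ℝ fun v => ?_
  rw [inner_gradient, fderiv_convolution_apply hk hkc (hg.locallyIntegrable (by norm_num)),
    inner_convolution hk hkc (hH.locallyIntegrable (by norm_num))]
  set κ : Space → ℝ := fun z => k (x - z) with hκ
  have hκs : ContDiff ℝ ∞ κ := hk.comp (contDiff_const.sub contDiff_id)
  have hκc : HasCompactSupport κ := hkc.comp_homeomorph (Homeomorph.subLeft x)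
  have hκd : ∀ z, fderiv ℝ κ z v = -fderiv ℝ k (x - z) v := by
    intro z
    have h1 : HasFDerivAt κ ((fderiv ℝ k (x - z)).comp (-ContinuousLinearMap.id ℝ Space)) z :=
      ((hk.differentiable (by simp)) (x - z)).hasFDerivAt.comp z
        ((hasFDerivAt_id z).const_sub x)
    rw [h1.fderiv]
    simp
  have hφd : ∀ z, fderiv ℝ (fun z => χ z * κ z) z v
      = χ z * fderiv ℝ κ z v + κ z * fderiv ℝ χ z v := by
    intro z
    rw [fderiv_fun_mul (hχ.differentiable (by simp) z) (hκs.differentiable (by simp) z)]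
    simp
  have hw := h.integral_eq (fun z => χ z * κ z) (hχ.mul hκs) hχc.mul_right hsub v
  simp only [hφd, hκd] at hw
  have i1 : Integrable (fun z => f z * (χ z * fderiv ℝ k (x - z) v)) (volume.restrict Ω) := by
    refine integrable_mul_of_test h.memLp ?_ hχc.mul_right
    have := (hk.continuous_fderiv (by simp)).comp
      (continuous_const.sub continuous_id : Continuous fun z => x - z)
    exact hχ.continuous.mul (this.clm_apply continuous_const)
  have i2 : Integrable (fun z => f z * (κ z * fderiv ℝ χ z v)) (volume.restrict Ω) := by
    refine integrable_mul_of_test h.memLp ?_ hκc.mul_right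
    exact hκs.continuous.mul ((hχ.continuous_fderiv (by simp)).clm_apply continuous_const)
  have i3 : Integrable (fun z => inner ℝ (G z) v * (χ z * κ z)) (volume.restrict Ω) :=
    integrable_mul_of_test (h.memLp_gradient.inner_const v) (hχ.continuous.mul hκs.continuous)
      hχc.mul_right
  have e1 : (fun z => fderiv ℝ k (x - z) v * Ω.indicator (fun z => f z * χ z) z)
      = Ω.indicator fun z => f z * (χ z * fderiv ℝ k (x - z) v) := by
    ext z
    by_cases hz : z ∈ Ω
    · simp only [indicator_of_mem hz]; ring
    · simp [indicator_of_notMem hz]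
  have e2 : (fun z => inner ℝ (Ω.indicator (fun z => χ z • G z + f z • gradient χ z) z) v * κ z)
      = Ω.indicator fun z => inner ℝ (G z) v * (χ z * κ z) + f z * (κ z * fderiv ℝ χ z v) := by
    ext z
    by_cases hz : z ∈ Ω
    · simp only [indicator_of_mem hz, inner_add_left, real_inner_smul_left, inner_gradient]; ring
    · simp [indicator_of_notMem hz]
  rw [e1, e2, integral_indicator hΩ.measurableSet, integral_indicator hΩ.measurableSet,
    integral_add i3 i2]
  have e3 : (fun z => f z * (χ z * -fderiv ℝ k (x - z) v + κ z * fderiv ℝ χ z v))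
      = fun z => f z * (κ z * fderiv ℝ χ z v) - f z * (χ z * fderiv ℝ k (x - z) v) := by
    ext z; ring
  rw [e3, integral_sub i2 i1] at hw
  linarith

/-- Convolving with a kernel concentrated near `-s • v` evaluates the function at points `x + s • (v
+ u)` with `u` small. By the cone condition these lie inside `Ω` for `x ∈ Ω` near `x₀`, so
differentiation commutes with this mollification throughout `Ω`. -/
theorem isC1Limit_cutoff {Ω : Set Space} (hΩ : IsOpen Ω) {x₀ v : Space} {r κ ε₀ : ℝ} (hr : 0 < r)
    (hκ : 0 < κ) (hε₀ : 0 < ε₀) (hcone : ∀ x ∈ Ω ∩ Metric.ball x₀ r,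
      ∀ ε ∈ Ioo 0 ε₀, ∀ u : Space, ‖u‖ ≤ κ → x + ε • (v + u) ∈ Ω)
    {f : Space → ℝ} {G : Space → Space} (h : HasH1Gradient Ω f G) {χ : Space → ℝ}
    (hχ : ContDiff ℝ ∞ χ) (hχc : HasCompactSupport χ)
    (hχs : tsupport χ ⊆ Metric.ball x₀ (r / 2)) :
    IsC1Limit Ω (fun z => f z * χ z) (fun z => χ z • G z + f z • gradient χ z) := by
  have hχ1 : ContDiff ℝ 1 χ := hχ.of_le (by simp)
  have hg := memLp_mul_of_test h.memLp hχ.continuous hχc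
  have hH := (memLp_smul_of_test h.memLp_gradient hχ.continuous hχc).add
        (memLp_mul_of_test h.memLp (continuous_gradient hχ1) (hasCompactSupport_gradient hχc))
  refine ⟨hg, hH, fun ε hε => ?_⟩
  have hg' : MemLp (Ω.indicator fun z => f z * χ z) 2 volume :=
    (memLp_indicator_iff_restrict hΩ.measurableSet).2 hg
  have hH' : MemLp (Ω.indicator fun z => χ z • G z + f z • gradient χ z) 2 volume :=
    (memLp_indicator_iff_restrict hΩ.measurableSet).2 hH
  have hev := ((tendsto_eLpNorm_translate hg').eventually (ge_mem_nhds (pos_iff_ne_zero.2 hε))).and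
    ((tendsto_eLpNorm_translate hH').eventually (ge_mem_nhds (pos_iff_ne_zero.2 hε)))
  obtain ⟨δ, hδ, hball⟩ := Metric.eventually_nhds_iff.1 hev
  have hvκ : 0 < ‖v‖ + κ := by positivity
  -- The bounds on `s` serve in turn the cone condition, the `L²` continuity of translations (shifts
  -- shorter than `δ`), and the requirement that a shift from `ball x₀ r` to the support of `χ` be
  -- shorter than `r / 2`.
  obtain ⟨s, hs0, hs⟩ : ∃ s, 0 < s ∧ s < min ε₀ (min (δ / (‖v‖ + κ)) (r / 2 / (‖v‖ + κ))) :=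
    exists_between (by positivity)
  simp only [lt_min_iff] at hs
  obtain ⟨hs1, hs2, hs3⟩ := hs
  rw [lt_div_iff₀ hvκ] at hs2 hs3
  obtain ⟨k, hk, hkc, hk0, hk1, hks⟩ := exists_shifted_kernel v hs0 hκ
  have hknorm : ∀ y, k y ≠ 0 → ‖y‖ ≤ s * (‖v‖ + κ) := by
    intro y hy
    have h1 := norm_sub_le (y + s • v) (s • v)
    rw [add_sub_cancel_right, norm_smul, Real.norm_eq_abs, abs_of_pos hs0] at h1
    linarith [hks y hy]
  have hkball : ∀ y, k y ≠ 0 → dist y 0 < δ := by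
    intro y hy
    rw [dist_zero_right]
    exact (hknorm y hy).trans_lt hs2
  have hgrad : ∀ x ∈ Ω,
      gradient (k ⋆[ContinuousLinearMap.lsmul ℝ ℝ, volume] Ω.indicator fun z => f z * χ z) x =
      (k ⋆[ContinuousLinearMap.lsmul ℝ ℝ, volume]
        Ω.indicator fun z => χ z • G z + f z • gradient χ z) x := by
    intro x hx
    refine gradient_convolution_cutoff hΩ h hχ hχc hk hkc ?_
    intro z hz
    have hzχ : z ∈ tsupport χ := tsupport_mul_subset_left hz
    have hzk : ‖x - z + s • v‖ ≤ κ * s := by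
      have hcl : IsClosed {z : Space | ‖x - z + s • v‖ ≤ κ * s} :=
        isClosed_le (by fun_prop) continuous_const
      refine closure_minimal (fun y hy => ?_) hcl hz
      exact hks _ (right_ne_zero_of_mul hy)
    have hz2 := hχs hzχ
    set u : Space := s⁻¹ • (z - x) - v with hu
    have hsu : s • (v + u) = z - x := by
      rw [hu, add_sub_cancel, smul_smul, mul_inv_cancel₀ hs0.ne', one_smul]
    have hun : ‖u‖ ≤ κ := by
      have h1 : s • u = -(x - z + s • v) := by
        rw [smul_add] at hsu
        have := eq_sub_of_add_eq' hsu
        rw [this]; abel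
      have h2 : s * ‖u‖ = ‖x - z + s • v‖ := by
        rw [← norm_neg (x - z + s • v), ← h1, norm_smul, Real.norm_eq_abs, abs_of_pos hs0]
      nlinarith
    have hxb : x ∈ Metric.ball x₀ r := by
      rw [Metric.mem_ball] at hz2 ⊢
      have h1 : dist x z ≤ s * (‖v‖ + κ) := by
        rw [dist_comm, dist_eq_norm, ← hsu, norm_smul, Real.norm_eq_abs, abs_of_pos hs0]
        gcongr
        exact (norm_add_le _ _).trans (by linarith)
      linarith [dist_triangle x z x₀]
    have := hcone x ⟨hx, hxb⟩ s ⟨hs0, hs1⟩ u hun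
    rwa [hsu, add_sub_cancel] at this
  refine ⟨k ⋆[ContinuousLinearMap.lsmul ℝ ℝ, volume] Ω.indicator fun z => f z * χ z, ?_, ?_, ?_, ?_⟩
  · exact hkc.contDiff_convolution_left _ (hk.of_le (by simp))
      (hg'.locallyIntegrable (by norm_num))
  · refine HasCompactSupport.convolution _ hkc ?_
    refine hχc.mono fun z hz => ?_
    rw [Function.mem_support] at hz ⊢
    by_cases hzΩ : z ∈ Ω
    · rw [indicator_of_mem hzΩ] at hz
      exact right_ne_zero_of_mul hz
    · exact absurd (indicator_of_notMem hzΩ _) hz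
  · refine le_trans (le_of_eq_of_le ?_ (eLpNorm_restrict_le _ 2 volume Ω))
      (eLpNorm_convolution_sub_le hk.continuous hkc hk0 hk1 hg'
        fun y hy => (hball (hkball y hy)).1)
    refine eLpNorm_congr_ae ?_
    filter_upwards [ae_restrict_mem hΩ.measurableSet] with x hx
    rw [indicator_of_mem hx]
  · refine le_trans (le_of_eq_of_le ?_ (eLpNorm_restrict_le _ 2 volume Ω))
      (eLpNorm_convolution_sub_le hk.continuous hkc hk0 hk1 hH'
        fun y hy => (hball (hkball y hy)).2)
    refine eLpNorm_congr_ae ?_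
    filter_upwards [ae_restrict_mem hΩ.measurableSet] with x hx
    rw [hgrad x hx, indicator_of_mem hx]

open scoped Manifold in
/-- Functions that are `C¹` up to the boundary are dense in `H¹(Ω)`. -/
theorem IsBoundedSmoothDomain.isC1Limit {Ω : Set Space} (hΩ : IsBoundedSmoothDomain Ω)
    {f : Space → ℝ} {G : Space → Space} (h : HasH1Gradient Ω f G) : IsC1Limit Ω f G := by
  have hcpt : IsCompact (closure Ω) := hΩ.isBounded.isCompact_closure
  choose! v r κ ε₀ hr hκ hε₀ hcone using
    fun (x₀ : Space) (hx₀ : x₀ ∈ closure Ω) => hΩ.exists_inward_cone hx₀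
  obtain ⟨t, htΩ, htcov⟩ := hcpt.elim_nhds_subcover (fun x => Metric.ball x (r x / 2))
    fun x hx => Metric.ball_mem_nhds x (by have := hr x hx; positivity)
  obtain ⟨p, hp⟩ := SmoothPartitionOfUnity.exists_isSubordinate 𝓘(ℝ, Space) hcpt.isClosed
    (fun i : t => Metric.ball (i : Space) (r i / 2)) (fun i => Metric.isOpen_ball)
    (fun x hx => by simpa using htcov hx)
  have hps : ∀ i, ContDiff ℝ ∞ (p i) := fun i => (p i).contMDiff.contDiff
  have hpc : ∀ i, HasCompactSupport (p i) := fun i =>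
    Metric.isCompact_of_isClosed_isBounded (isClosed_tsupport _)
      (Metric.isBounded_ball.subset (hp i))
  have hsum : ∀ x ∈ closure Ω, ∑ i, p i x = 1 := by
    intro x hx
    rw [← finsum_eq_sum_of_fintype]
    exact p.sum_eq_one hx
  -- The partition sums to one on a neighbourhood of each point of `Ω`, so the terms `f • ∇χ`
  -- created by localisation add up to zero.
  have hgrad : ∀ x ∈ Ω, ∑ i, gradient (p i) x = 0 := by
    intro x hx
    refine ext_inner_right ℝ fun u => ?_
    rw [sum_inner]
    simp only [inner_gradient, inner_zero_left]
    have h1 : (fun y => ∑ i, p i y) =ᶠ[𝓝 x] fun _ => (1 : ℝ) := by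
      filter_upwards [hΩ.isOpen.mem_nhds hx] with y hy using hsum y (subset_closure hy)
    have h2 := h1.fderiv_eq (𝕜 := ℝ)
    rw [fderiv_fun_sum fun i _ => (hps i).differentiable (by simp) x, fderiv_fun_const] at h2
    have h3 := congrArg (fun L : Space →L[ℝ] ℝ => L u) h2
    simpa using h3
  have hlim := IsC1Limit.sum Finset.univ (w := fun (i : t) z => f z * p i z)
    (G := fun (i : t) z => p i z • G z + f z • gradient (p i) z) fun i _ =>
      isC1Limit_cutoff hΩ.isOpen (hr i (htΩ i i.2)) (hκ i (htΩ i i.2)) (hε₀ i (htΩ i i.2))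
        (hcone i (htΩ i i.2)) h (hps i) (hpc i) (hp i)
  refine hlim.congr ?_ ?_
  · filter_upwards [ae_restrict_mem hΩ.isOpen.measurableSet] with x hx
    rw [← Finset.mul_sum, hsum x (subset_closure hx), mul_one]
  · filter_upwards [ae_restrict_mem hΩ.isOpen.measurableSet] with x hx
    rw [Finset.sum_add_distrib, ← Finset.sum_smul, ← Finset.smul_sum,
      hsum x (subset_closure hx), hgrad x hx, one_smul, smul_zero, add_zero]

theorem IsC1Limit.exists_seq {Ω : Set Space} {w : Space → ℝ} {G : Space → Space}
    (h : IsC1Limit Ω w G) : ∃ ψ : ℕ → Space → ℝ, (∀ k, ContDiff ℝ 1 (ψ k)) ∧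
      (∀ k, HasCompactSupport (ψ k)) ∧
      Tendsto (fun k => eLpNorm (ψ k - w) 2 (volume.restrict Ω)) atTop (𝓝 0) ∧
      Tendsto (fun k => eLpNorm (gradient (ψ k) - G) 2 (volume.restrict Ω)) atTop (𝓝 0) ∧
      ∀ᵐ x ∂(volume.restrict Ω), Tendsto (fun k => ψ k x) atTop (𝓝 (w x)) := by
  choose ψ h1 h2 h3 h4 using fun k : ℕ => h.approx ((k : ℝ≥0∞) + 1)⁻¹ (by simp)
  have hlim : Tendsto (fun k : ℕ => ((k : ℝ≥0∞) + 1)⁻¹) atTop (𝓝 0) := by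
    have := ENNReal.tendsto_inv_nat_nhds_zero.comp (tendsto_add_atTop_nat 1)
    refine this.congr fun k => by simp
  have t1 : Tendsto (fun k => eLpNorm (ψ k - w) 2 (volume.restrict Ω)) atTop (𝓝 0) :=
    tendsto_of_tendsto_of_tendsto_of_le_of_le tendsto_const_nhds hlim (fun _ => bot_le) h3
  have t2 : Tendsto (fun k => eLpNorm (gradient (ψ k) - G) 2 (volume.restrict Ω)) atTop (𝓝 0) :=
    tendsto_of_tendsto_of_tendsto_of_le_of_le tendsto_const_nhds hlim (fun _ => bot_le) h4
  have hm := tendstoInMeasure_of_tendsto_eLpNorm (by norm_num)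
    (fun k => (h1 k).continuous.aestronglyMeasurable) h.memLp.1 t1
  obtain ⟨ns, hns, hae⟩ := hm.exists_seq_tendsto_ae
  exact ⟨fun k => ψ (ns k), fun k => h1 _, fun k => h2 _, t1.comp hns.tendsto_atTop,
    t2.comp hns.tendsto_atTop, hae⟩

theorem gradient_comp {F : ℝ → ℝ} (hF : ContDiff ℝ 1 F) {ψ : Space → ℝ} (hψ : ContDiff ℝ 1 ψ)
    (x : Space) : gradient (fun y => F (ψ y)) x = deriv F (ψ x) • gradient ψ x := by
  refine ext_inner_right ℝ fun v => ?_
  rw [inner_gradient, real_inner_smul_left, inner_gradient]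
  have := ((hF.differentiable (by norm_num) (ψ x)).hasDerivAt.comp_hasFDerivAt x
    (hψ.differentiable (by norm_num) x).hasFDerivAt).fderiv
  have e : (fun y => F (ψ y)) = F ∘ ψ := rfl
  rw [e, this]
  simp

/-- Chain rule: composition with a `C¹` function with bounded derivative. -/
theorem IsC1Limit.comp {Ω : Set Space} {w : Space → ℝ} {G : Space → Space}
    (h : IsC1Limit Ω w G) {F : ℝ → ℝ} (hF : ContDiff ℝ 1 F) (hF0 : F 0 = 0) {M : ℝ}
    (hM : ∀ a, |deriv F a| ≤ M) :
    IsC1Limit Ω (fun x => F (w x)) (fun x => deriv F (w x) • G x) := by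
  have hM0 : 0 ≤ M := (abs_nonneg _).trans (hM 0)
  have hFd : Continuous (deriv F) := hF.continuous_deriv (by norm_num)
  have hlip : ∀ a b, ‖F a - F b‖ ≤ M * ‖a - b‖ := fun a b =>
    Convex.norm_image_sub_le_of_norm_deriv_le (s := univ)
      (fun x _ => hF.differentiable (by norm_num) x) (fun x _ => hM x) convex_univ trivial trivial
  have hwm := h.memLp.1
  have hGm := h.memLp_gradient.1
  have hdm : ∀ {u : Space → ℝ}, AEStronglyMeasurable u (volume.restrict Ω) →
      AEStronglyMeasurable (fun x => deriv F (u x)) (volume.restrict Ω) := fun hu =>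
    hFd.comp_aestronglyMeasurable hu
  obtain ⟨ψ, h1, h2, h3, h4, h5⟩ := h.exists_seq
  -- The gradient error splits into `F'(ψ_k) (∇ψ_k - G)`, controlled by `M`, and this term, which
  -- has no rate. It tends to zero by dominated convergence, using almost everywhere convergence of
  -- `ψ_k`.
  have hdom : Tendsto (fun k => eLpNorm (fun x => (deriv F (ψ k x) - deriv F (w x)) • G x) 2
      (volume.restrict Ω)) atTop (𝓝 0) := by
    have hz : Tendsto (fun k => eLpNorm (fun x => (deriv F (ψ k x) - deriv F (w x)) • G x) 2
      (volume.restrict Ω) ^ 2) atTop (𝓝 0) := by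
      simp only [eLpNorm_two_sq]
      have := tendsto_lintegral_of_dominated_convergence'
        (μ := volume.restrict Ω) (f := fun _ => (0 : ℝ≥0∞))
        (F := fun k x => ‖(deriv F (ψ k x) - deriv F (w x)) • G x‖ₑ ^ 2)
        (fun x => ‖(2 * M) • G x‖ₑ ^ 2)
        (fun k => ((((hdm (h1 k).continuous.aestronglyMeasurable).sub (hdm hwm)).smul
          hGm).enorm).pow_const 2) ?_ ?_ ?_
      · simpa using this
      · intro k
        refine Eventually.of_forall fun x => ?_
        simp only [enorm_smul]
        gcongr
        rw [enorm_le_iff_norm_le, Real.norm_of_nonneg (show 0 ≤ 2 * M by positivity)]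
        refine (norm_sub_le _ _).trans ?_
        simp only [Real.norm_eq_abs]
        linarith [hM (ψ k x), hM (w x)]
      · rw [← eLpNorm_two_sq]
        exact (ENNReal.pow_lt_top (h.memLp_gradient.const_smul (2 * M)).2).ne
      · filter_upwards [h5] with x hx
        have t1 : Tendsto (fun k => ‖(deriv F (ψ k x) - deriv F (w x)) • G x‖ₑ ^ 2) atTop
            (𝓝 (‖(deriv F (w x) - deriv F (w x)) • G x‖ₑ ^ 2)) := by
          refine ENNReal.Tendsto.pow (Tendsto.enorm ?_)
          exact (((hFd.tendsto _).comp hx).sub tendsto_const_nhds).smul_const _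
        simpa using t1
    have := (ENNReal.continuous_rpow_const (y := (2 : ℝ)⁻¹)).tendsto 0 |>.comp hz
    simp only [Function.comp_def] at this
    rw [ENNReal.zero_rpow_of_pos (by norm_num)] at this
    refine this.congr fun k => ?_
    rw [← ENNReal.rpow_natCast, ← ENNReal.rpow_mul]
    norm_num
  have hmem1 : MemLp (fun x => F (w x)) 2 (volume.restrict Ω) := by
    refine h.memLp.of_le_mul (c := M) (hF.continuous.comp_aestronglyMeasurable hwm)
      (Eventually.of_forall fun x => ?_)
    have := hlip (w x) 0
    simpa [hF0] using this
  have hmem2 : MemLp (fun x => deriv F (w x) • G x) 2 (volume.restrict Ω) := by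
    refine h.memLp_gradient.of_le_mul (c := M) ((hdm hwm).smul hGm)
      (Eventually.of_forall fun x => ?_)
    rw [norm_smul]
    exact mul_le_mul_of_nonneg_right (hM _) (norm_nonneg _)
  refine ⟨hmem1, hmem2, fun ε hε => ?_⟩
  have t1 : Tendsto (fun k => ENNReal.ofReal M * eLpNorm (ψ k - w) 2 (volume.restrict Ω)) atTop
      (𝓝 0) := by
    simpa using ENNReal.Tendsto.const_mul (a := ENNReal.ofReal M) h3 (Or.inr ENNReal.ofReal_ne_top)
  have t2 : Tendsto (fun k => ENNReal.ofReal M *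
      eLpNorm (gradient (ψ k) - G) 2 (volume.restrict Ω) +
      eLpNorm (fun x => (deriv F (ψ k x) - deriv F (w x)) • G x) 2 (volume.restrict Ω)) atTop
      (𝓝 0) := by
    simpa using (ENNReal.Tendsto.const_mul (a := ENNReal.ofReal M) h4
      (Or.inr ENNReal.ofReal_ne_top)).add hdom
  obtain ⟨k, hk1, hk2⟩ := ((t1.eventually (ge_mem_nhds (pos_iff_ne_zero.2 hε))).and
    (t2.eventually (ge_mem_nhds (pos_iff_ne_zero.2 hε)))).exists
  refine ⟨fun x => F (ψ k x), hF.comp (h1 k), (h2 k).comp_left hF0, ?_, ?_⟩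
  · refine le_trans ?_ hk1
    exact eLpNorm_le_mul_eLpNorm_of_ae_le_mul (Eventually.of_forall fun x => hlip _ _) 2
  · refine le_trans ?_ hk2
    have e : (fun x => gradient (fun x => F (ψ k x)) x - deriv F (w x) • G x)
        = (fun x => deriv F (ψ k x) • (gradient (ψ k) - G) x) +
          fun x => (deriv F (ψ k x) - deriv F (w x)) • G x := by
      ext1 x
      rw [gradient_comp hF (h1 k)]
      simp only [Pi.add_apply, Pi.sub_apply, smul_sub, sub_smul]
      abel
    have m0 := hdm (u := ψ k) (h1 k).continuous.aestronglyMeasurable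
    have m1 : AEStronglyMeasurable (gradient (ψ k) - G) (volume.restrict Ω) :=
      (continuous_gradient (h1 k)).aestronglyMeasurable.sub hGm
    rw [e]
    refine (eLpNorm_add_le (m0.smul m1) ((m0.sub (hdm hwm)).smul hGm) (by norm_num)).trans ?_
    refine add_le_add ?_ le_rfl
    refine eLpNorm_le_mul_eLpNorm_of_ae_le_mul (Eventually.of_forall fun x => ?_) 2
    rw [Pi.smul_apply', norm_smul]
    exact mul_le_mul_of_nonneg_right (hM _) (norm_nonneg _)

/-! ### Continuous functions of time with an integrable weak derivative. -/

theorem deriv_smoothTransition_eq_zero {q : ℝ} (hq : q ∉ Icc (0 : ℝ) 1) :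
    deriv Real.smoothTransition q = 0 := by
  rw [mem_Icc, not_and_or, not_le, not_le] at hq
  rcases hq with hq | hq
  · have : Real.smoothTransition =ᶠ[𝓝 q] fun _ => 0 := by
      filter_upwards [Iio_mem_nhds hq] with y hy
      exact Real.smoothTransition.zero_of_nonpos (le_of_lt hy)
    rw [this.deriv_eq, deriv_const]
  · have : Real.smoothTransition =ᶠ[𝓝 q] fun _ => 1 := by
      filter_upwards [Ioi_mem_nhds hq] with y hy
      exact Real.smoothTransition.one_of_one_le (le_of_lt hy)
    rw [this.deriv_eq, deriv_const]

theorem continuous_deriv_smoothTransition : Continuous (deriv Real.smoothTransition) :=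
  (Real.smoothTransition.contDiff (n := 1)).continuous_deriv (by norm_num)

/-- The derivative of the steep step is an approximate identity on `[s, s + ε]`. The substitution `r
= s + ε q` gives an integral over `[0, 1]` that is continuous in `ε`. -/
theorem tendsto_integral_deriv_smoothTransition {u : ℝ → ℝ} (hu : Continuous u) (s : ℝ) :
    Tendsto (fun ε => ∫ r, deriv (fun r => Real.smoothTransition ((r - s) / ε)) r * u r)
      (𝓝[>] 0) (𝓝 (u s)) := by
  set S := Real.smoothTransition
  have hS : Differentiable ℝ S :=
    (Real.smoothTransition.contDiff (n := 1)).differentiable (by norm_num)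
  have hF : Continuous fun ε => ∫ q in (0 : ℝ)..1, deriv S q * u (s + ε * q) := by
    refine intervalIntegral.continuous_parametric_intervalIntegral_of_continuous' ?_ 0 1
    have := continuous_deriv_smoothTransition
    fun_prop
  have h0 : ∫ q in (0 : ℝ)..1, deriv S q * u (s + 0 * q) = u s := by
    simp only [zero_mul, add_zero]
    rw [intervalIntegral.integral_mul_const, intervalIntegral.integral_deriv_eq_sub
      (fun x _ => hS x) (continuous_deriv_smoothTransition.intervalIntegrable _ _)]
    simp [S]
  have h1 := (hF.tendsto 0).mono_left (nhdsWithin_le_nhds (s := Ioi 0))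
  rw [h0] at h1
  refine h1.congr' ?_
  filter_upwards [self_mem_nhdsWithin] with ε hε
  have hε : 0 < ε := hε
  have hd : ∀ r, deriv (fun r => S ((r - s) / ε)) r = deriv S ((r - s) / ε) * ε⁻¹ := by
    intro r
    have h2 : HasDerivAt (fun r : ℝ => (r - s) / ε) (ε⁻¹) r := by
      simpa using ((hasDerivAt_id r).sub_const s).div_const ε
    exact ((hS _).hasDerivAt.comp r h2).deriv
  set g : ℝ → ℝ := fun q => deriv S q * u (s + ε * q) with hg
  have e1 : (fun r => deriv (fun r => S ((r - s) / ε)) r * u r)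
      = fun r => ε⁻¹ * (fun r => g (r / ε)) (r - s) := by
    ext r
    simp only [hd, hg]
    rw [mul_div_cancel₀ _ hε.ne', add_sub_cancel]
    ring
  rw [e1, integral_const_mul, integral_sub_right_eq_self (fun r => g (r / ε)),
    Measure.integral_comp_div, abs_of_pos hε, smul_eq_mul, ← mul_assoc, inv_mul_cancel₀ hε.ne',
    one_mul, intervalIntegral.integral_of_le zero_le_one, ← integral_Icc_eq_integral_Ioc]
  refine setIntegral_eq_integral_of_forall_compl_eq_zero fun q hq => ?_
  exact mul_eq_zero_of_left (deriv_smoothTransition_eq_zero hq) _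

theorem tendsto_smoothTransition_div (s r : ℝ) :
    Tendsto (fun ε => Real.smoothTransition ((r - s) / ε)) (𝓝[>] 0)
      (𝓝 ((Ioi s).indicator (fun _ => (1 : ℝ)) r)) := by
  by_cases h : r ∈ Ioi s
  · rw [indicator_of_mem h]
    have hrs : 0 < r - s := sub_pos.2 h
    refine tendsto_const_nhds.congr' ?_
    filter_upwards [Ioo_mem_nhdsGT hrs] with ε hε
    exact (Real.smoothTransition.one_of_one_le ((one_le_div hε.1).2 hε.2.le)).symm
  · rw [indicator_of_notMem h]
    refine tendsto_const_nhds.congr' ?_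
    filter_upwards [self_mem_nhdsWithin] with ε hε
    exact (Real.smoothTransition.zero_of_nonpos
      (div_nonpos_of_nonpos_of_nonneg (by simpa using h) (le_of_lt hε))).symm

/-- The projection of `ℝ` onto `[0, T]`. -/
def clamp (T t : ℝ) : ℝ := max 0 (min t T)

theorem continuous_clamp (T : ℝ) : Continuous (clamp T) :=
  continuous_const.max (continuous_id.min continuous_const)

theorem clamp_mem {T : ℝ} (hT : 0 ≤ T) (t : ℝ) : clamp T t ∈ Icc 0 T :=
  ⟨le_max_left _ _, max_le hT (min_le_right _ _)⟩

theorem clamp_of_mem {T t : ℝ} (ht : t ∈ Icc 0 T) : clamp T t = t := by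
  rw [clamp, min_eq_left ht.2, max_eq_right ht.1]

/-- A continuous function with integrable weak derivative is the integral of that derivative. -/
theorem sub_eq_integral_of_weak_deriv {T : ℝ} (hT : 0 < T) {u β : ℝ → ℝ} (hu : Continuous u)
    (huc : ∀ t, u t = u (clamp T t)) (hβ : Integrable β) (hβ0 : ∀ t, t ∉ Ioo 0 T → β t = 0)
    (hweak : ∀ θ : ℝ → ℝ, ContDiff ℝ 1 θ → HasCompactSupport θ → tsupport θ ⊆ Ioo 0 T →
      (∫ t, deriv θ t * u t) + ∫ t, θ t * β t = 0) (s t : ℝ) :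
    u t - u s = ∫ r in s..t, β r := by
  -- The test function is a difference of two steep steps, which tends to the indicator of `(s, t]`
  -- while its derivative tends to a unit mass at `s` minus one at `t`.
  have key : ∀ s t, 0 < s → s < t → t < T → u t - u s = ∫ r in s..t, β r := by
    intro s t hs hst htT
    set S := Real.smoothTransition with hS
    have hSd : ∀ s ε : ℝ, Differentiable ℝ fun r => S ((r - s) / ε) := fun s ε =>
      ((Real.smoothTransition.contDiff (n := 1)).differentiable (by norm_num)).comp
        ((differentiable_id.sub_const s).div_const ε)
    have hSc : ∀ s ε : ℝ, ContDiff ℝ 1 fun r => S ((r - s) / ε) := fun s ε =>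
      (Real.smoothTransition.contDiff (n := 1)).comp ((contDiff_id.sub contDiff_const).div_const ε)
    have t1 := (tendsto_integral_deriv_smoothTransition hu s).sub
      (tendsto_integral_deriv_smoothTransition hu t)
    have t2 : Tendsto (fun ε => ∫ r, (S ((r - s) / ε) - S ((r - t) / ε)) * β r) (𝓝[>] 0)
        (𝓝 (∫ r, ((Ioi s).indicator (fun _ => (1 : ℝ)) r -
          (Ioi t).indicator (fun _ => (1 : ℝ)) r) * β r)) := by
      refine tendsto_integral_filter_of_dominated_convergence (fun r => |β r|) ?_ ?_ hβ.abs ?_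
      · refine Eventually.of_forall fun ε => ?_
        exact (((hSc s ε).sub (hSc t ε)).continuous.aestronglyMeasurable).mul hβ.1
      · refine Eventually.of_forall fun ε => Eventually.of_forall fun r => ?_
        rw [norm_mul, Real.norm_eq_abs, Real.norm_eq_abs]
        refine mul_le_of_le_one_left (abs_nonneg _) (abs_le.2 ⟨?_, ?_⟩) <;>
        linarith [Real.smoothTransition.nonneg ((r - s) / ε),
          Real.smoothTransition.nonneg ((r - t) / ε),
          Real.smoothTransition.le_one ((r - s) / ε), Real.smoothTransition.le_one ((r - t) / ε)]
      · exact Eventually.of_forall fun r => ((tendsto_smoothTransition_div s r).sub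
          (tendsto_smoothTransition_div t r)).mul_const _
    have e2 : ∫ r, ((Ioi s).indicator (fun _ => (1 : ℝ)) r -
          (Ioi t).indicator (fun _ => (1 : ℝ)) r) * β r = ∫ r in s..t, β r := by
      rw [intervalIntegral.integral_of_le hst.le, ← integral_indicator measurableSet_Ioc]
      refine integral_congr_ae (Eventually.of_forall fun r => ?_)
      simp only [indicator_apply, mem_Ioi, mem_Ioc]
      by_cases h1 : s < r <;> by_cases h2 : t < r
      · simp [h1, h2]
      · simp [h1, h2, not_lt.1 h2]
      · exact absurd (hst.trans h2) h1
      · simp [h1, h2]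
    have hlim := t1.add t2
    rw [e2] at hlim
    have hzero : Tendsto (fun _ : ℝ => (0 : ℝ)) (𝓝[>] 0) (𝓝 (u s - u t + ∫ r in s..t, β r)) := by
      refine hlim.congr' ?_
      -- The restriction `ε < T - t` keeps the support, contained in `[s, t + ε]`, inside `(0, T)`.
      filter_upwards [Ioo_mem_nhdsGT (sub_pos.2 htT)] with ε hε
      have hsupp : ∀ r, r ∉ Icc s (t + ε) → S ((r - s) / ε) - S ((r - t) / ε) = 0 := by
        intro r hr
        rw [mem_Icc, not_and_or, not_le, not_le] at hr
        rcases hr with hr | hr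
        · rw [hS, Real.smoothTransition.zero_of_nonpos, Real.smoothTransition.zero_of_nonpos,
            sub_zero] <;>
          exact div_nonpos_of_nonpos_of_nonneg (by linarith) hε.1.le
        · rw [hS, Real.smoothTransition.one_of_one_le, Real.smoothTransition.one_of_one_le,
            sub_self] <;>
          exact (one_le_div hε.1).2 (by linarith)
      have hts : tsupport (fun r => S ((r - s) / ε) - S ((r - t) / ε)) ⊆ Icc s (t + ε) :=
        closure_minimal (fun r hr => by_contra fun h => hr (hsupp r h)) isClosed_Icc
      have hcs : HasCompactSupport fun r => S ((r - s) / ε) - S ((r - t) / ε) :=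
        HasCompactSupport.intro isCompact_Icc hsupp
      have hint : ∀ s, Integrable fun r => deriv (fun r => S ((r - s) / ε)) r * u r := by
        intro s
        have hc : HasCompactSupport (deriv (fun r => S ((r - s) / ε))) := by
          refine HasCompactSupport.intro (isCompact_Icc (a := s) (b := s + ε)) fun r hr => ?_
          have h2 : HasDerivAt (fun r : ℝ => (r - s) / ε) (ε⁻¹) r := by
            simpa using ((hasDerivAt_id r).sub_const s).div_const ε
          have h3 : Differentiable ℝ S :=
            (Real.smoothTransition.contDiff (n := 1)).differentiable (by norm_num)
          have h4 : deriv (fun r => S ((r - s) / ε)) r = deriv S ((r - s) / ε) * ε⁻¹ :=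
            ((h3 _).hasDerivAt.comp r h2).deriv
          rw [h4, deriv_smoothTransition_eq_zero, zero_mul]
          rintro ⟨h5, h6⟩
          rw [div_le_one hε.1] at h6
          rw [le_div_iff₀ hε.1, zero_mul] at h5
          exact hr ⟨by linarith, by linarith⟩
        exact (((hSc s ε).continuous_deriv (by norm_num)).mul hu).integrable_of_hasCompactSupport
          hc.mul_right
      have := hweak _ ((hSc s ε).sub (hSc t ε)) hcs
        (hts.trans fun r hr => ⟨hs.trans_le hr.1, by linarith [hr.2, hε.2]⟩)
      rw [← this, ← integral_sub (hint s) (hint t)]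
      congr 1
      refine integral_congr_ae (Eventually.of_forall fun r => ?_)
      simp only
      rw [deriv_fun_sub (hSd s ε r) (hSd t ε r), sub_mul]
    have := tendsto_nhds_unique hzero tendsto_const_nhds
    linarith
  have hβi : ∀ a b, IntervalIntegrable β volume a b := fun a b => hβ.intervalIntegrable
  -- `U` is constant on `(0, T)` by `key`, on `[0, T]` by continuity, and on the whole line because
  -- `u` is frozen and `β` vanishes outside.
  set U : ℝ → ℝ := fun t => u t - ∫ r in (0 : ℝ)..t, β r with hU
  have hUc : Continuous U := hu.sub (intervalIntegral.continuous_primitive hβi 0)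
  have hclamp : ∀ t, U t = U (clamp T t) := by
    intro t
    have h1 : ∫ r in (clamp T t)..t, β r = 0 := by
      refine intervalIntegral.integral_zero_ae (Eventually.of_forall fun r hr => hβ0 r ?_)
      rintro ⟨h3, h4⟩
      rcases le_total t 0 with h | h
      · rw [clamp, min_eq_left (h.trans hT.le), max_eq_left h, uIoc_of_ge h] at hr
        linarith [hr.2]
      rcases le_total t T with h' | h'
      · rw [clamp_of_mem ⟨h, h'⟩] at hr
        simp at hr
      · rw [clamp, min_eq_right h', max_eq_right hT.le, uIoc_of_le h'] at hr
        linarith [hr.1]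
    simp only [hU]
    rw [huc t, ← intervalIntegral.integral_add_adjacent_intervals (hβi 0 (clamp T t))
      (hβi (clamp T t) t), h1, add_zero]
  have hconst : ∀ t ∈ Ioo 0 T, U t = U (T / 2) := by
    have h1 : ∀ s t, 0 < s → s < t → t < T → U s = U t := by
      intro s t hs hst ht
      have := key s t hs hst ht
      rw [← intervalIntegral.integral_interval_sub_left (hβi 0 t) (hβi 0 s)] at this
      simp only [hU]
      linarith
    intro t ht
    rcases lt_trichotomy t (T / 2) with h | h | h
    · exact h1 t (T / 2) ht.1 h (by linarith)
    · rw [h]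
    · exact (h1 (T / 2) t (by linarith) h ht.2).symm
  have hconst' : ∀ t ∈ Icc 0 T, U t = U (T / 2) := by
    rw [← closure_Ioo hT.ne]
    intro t ht
    exact closure_minimal hconst (isClosed_eq hUc continuous_const) ht
  have hall : ∀ t, U t = U (T / 2) := fun t =>
    (hclamp t).trans (hconst' _ (clamp_mem hT.le t))
  have h1 := (hall t).trans (hall s).symm
  simp only [hU] at h1
  rw [← intervalIntegral.integral_interval_sub_left (hβi 0 t) (hβi 0 s)]
  linarith

/-! ### Conservation laws tested with functions of `H¹(Ω)`. -/

theorem tendsto_integral_inner {α E ι : Type*} [MeasurableSpace α] {μ : Measure α}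
    [NormedAddCommGroup E] [InnerProductSpace ℝ E] {l : Filter ι} {f : α → E} {g : ι → α → E}
    {g₀ : α → E} (hf : MemLp f 2 μ) (hg : ∀ k, MemLp (g k) 2 μ) (hg₀ : MemLp g₀ 2 μ)
    (h : Tendsto (fun k => eLpNorm (g k - g₀) 2 μ) l (𝓝 0)) :
    Tendsto (fun k => ∫ x, inner ℝ (f x) (g k x) ∂μ) l (𝓝 (∫ x, inner ℝ (f x) (g₀ x) ∂μ)) := by
  have key : ∀ {g : α → E} (hg : MemLp g 2 μ),
      ∫ x, inner ℝ (f x) (g x) ∂μ = inner ℝ (hf.toLp f) (hg.toLp g) := by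
    intro g hg
    rw [L2.inner_def]
    refine integral_congr_ae ?_
    filter_upwards [hf.coeFn_toLp, hg.coeFn_toLp] with x h1 h2
    rw [h1, h2]
  rw [key hg₀]
  simp only [fun k => key (hg k)]
  have h1 : Tendsto (fun k => (hg k).toLp (g k)) l (𝓝 (hg₀.toLp g₀)) :=
    (Lp.tendsto_Lp_iff_tendsto_eLpNorm'' _ hg _ hg₀).2 h
  exact tendsto_const_nhds.inner h1

theorem integrable_inner {α E : Type*} [MeasurableSpace α] {μ : Measure α}
    [NormedAddCommGroup E] [InnerProductSpace ℝ E] {f g : α → E} (hf : MemLp f 2 μ)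
    (hg : MemLp g 2 μ) : Integrable (fun x => inner ℝ (f x) (g x)) μ := by
  refine (L2.integrable_inner (𝕜 := ℝ) (hf.toLp f) (hg.toLp g)).congr ?_
  filter_upwards [hf.coeFn_toLp, hg.coeFn_toLp] with x h1 h2
  rw [h1, h2]

/-- `a`, extended to all times by its values at the ends of `[0, T]`, is continuous with values in
`L²(Ω)` and satisfies `∂ₜ a + div J = 0` with the no-flux condition, for a square integrable flux
`J`, extended by zero to all times. -/
structure IsConserved (Ω : Set Space) (T : ℝ) (a : ℝ → Space → ℝ) (J : ℝ × Space → Space) :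
    Prop where
  memLp_flux : MemLp J 2 ((volume : Measure ℝ).prod (volume.restrict Ω))
  flux_eq_zero : ∀ t x, t ∉ Ioo 0 T → J (t, x) = 0
  memLp : ∀ t, MemLp (a t) 2 (volume.restrict Ω)
  continuous : ∀ t, Tendsto (fun s => eLpNorm (a s - a t) 2 (volume.restrict Ω)) (𝓝 t) (𝓝 0)
  clamp_eq : ∀ t, a t = a (clamp T t)
  weak_form : ∀ φ : ℝ × Space → ℝ, IsTestFunction T φ →
    (∫ t in Ioo 0 T, ∫ x in Ω, a t x * deriv (fun s => φ (s, x)) t) +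
      (∫ t in Ioo 0 T, ∫ x in Ω, inner ℝ (J (t, x)) (gradient (fun y => φ (t, y)) x)) = 0

theorem isTestFunction_mul {T : ℝ} {θ : ℝ → ℝ} {ψ : Space → ℝ} (h1 : ContDiff ℝ 1 θ)
    (h2 : HasCompactSupport θ) (h3 : tsupport θ ⊆ Ioo 0 T) (hψ : ContDiff ℝ 1 ψ)
    (hψc : HasCompactSupport ψ) : IsTestFunction T fun p => θ p.1 * ψ p.2 := by
  have hsub : tsupport (fun p : ℝ × Space => θ p.1 * ψ p.2) ⊆ tsupport θ ×ˢ tsupport ψ := by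
    refine closure_minimal (fun p hp => ?_) ((isClosed_tsupport _).prod (isClosed_tsupport _))
    exact ⟨subset_tsupport _ (left_ne_zero_of_mul hp), subset_tsupport _ (right_ne_zero_of_mul hp)⟩
  refine ⟨(h1.comp contDiff_fst).mul (hψ.comp contDiff_snd), ?_, ?_⟩
  · exact IsCompact.of_isClosed_subset (h2.prod hψc) (isClosed_tsupport _) hsub
  · exact hsub.trans (prod_mono h3 (subset_univ _))

theorem gradient_const_mul (b : ℝ) {ψ : Space → ℝ} (hψ : ContDiff ℝ 1 ψ) (x : Space) :
    gradient (fun y => b * ψ y) x = b • gradient ψ x := by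
  refine ext_inner_right ℝ fun v => ?_
  rw [inner_gradient, real_inner_smul_left, inner_gradient,
    fderiv_const_mul (hψ.differentiable (by norm_num) x)]
  simp

section

variable {Ω : Set Space} {T : ℝ} {a : ℝ → Space → ℝ} {J : ℝ × Space → Space}

theorem IsConserved.continuous_integral (h : IsConserved Ω T a J) {ψ : Space → ℝ}
    (hψ : MemLp ψ 2 (volume.restrict Ω)) : Continuous fun t => ∫ x in Ω, a t x * ψ x := by
  refine continuous_iff_continuousAt.2 fun t => ?_
  have := tendsto_integral_inner hψ h.memLp (h.memLp t) (h.continuous t)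
  simpa [ContinuousAt] using this

theorem IsConserved.integrable_inner_prod (h : IsConserved Ω T a J) {K : Space → Space}
    (hK : MemLp K 2 (volume.restrict Ω)) :
    Integrable (fun p : ℝ × Space => inner ℝ (J p) (K p.2))
      ((volume : Measure ℝ).prod (volume.restrict Ω)) := by
  -- `K`, being constant in time, need not be square integrable over all times. It is cut off to
  -- `(0, T)`, outside of which `J` vanishes.
  set f : ℝ × Space → Space := fun p => (Ioo 0 T).indicator (fun _ => K p.2) p.1 with hf
  have hK' : MemLp f 2 ((volume : Measure ℝ).prod (volume.restrict Ω)) := by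
    have h1 : MemLp (fun p : ℝ × Space => K p.2) 2 (((volume : Measure ℝ).prod
        (volume.restrict Ω)).restrict (Ioo 0 T ×ˢ univ)) := by
      rw [← Measure.prod_restrict, Measure.restrict_univ]
      exact hK.comp_snd _
    rw [← memLp_indicator_iff_restrict (measurableSet_Ioo.prod MeasurableSet.univ)] at h1
    refine (memLp_congr_ae (Eventually.of_forall fun p => ?_)).1 h1
    simp [hf, indicator_apply]
  refine (integrable_inner h.memLp_flux hK').congr (Eventually.of_forall fun p => ?_)
  by_cases hp : p.1 ∈ Ioo 0 T
  · simp only [hf, indicator_of_mem hp]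
  · simp [hf, indicator_of_notMem hp, h.flux_eq_zero p.1 p.2 hp]

/-- The tests `θ t * ψ x` show that the pairing of `a t` with `ψ` has the flux pairing as weak time
derivative. -/
theorem IsConserved.integral_sub_of_test (hT : 0 < T) (h : IsConserved Ω T a J) {ψ : Space → ℝ}
    (hψ : ContDiff ℝ 1 ψ) (hψc : HasCompactSupport ψ) (s t : ℝ) :
    (∫ x in Ω, a t x * ψ x) - ∫ x in Ω, a s x * ψ x
      = ∫ r in s..t, ∫ x in Ω, inner ℝ (J (r, x)) (gradient ψ x) := by
  have hK := memLp_of_test (continuous_gradient hψ) (hasCompactSupport_gradient hψc) Ω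
  refine sub_eq_integral_of_weak_deriv hT
    (h.continuous_integral (memLp_of_test hψ.continuous hψc Ω)) (fun t => by rw [h.clamp_eq t])
    (h.integrable_inner_prod hK).integral_prod_left ?_ ?_ s t
  · intro t ht
    simp [fun x => h.flux_eq_zero t x ht]
  · intro θ h1 h2 h3
    have h0 : ∀ r, r ∉ Ioo 0 T → θ r = 0 := fun r hr => image_eq_zero_of_notMem_tsupport
      fun hr' => hr (h3 hr')
    have h0' : ∀ r, r ∉ Ioo 0 T → deriv θ r = 0 := fun r hr =>
      image_eq_zero_of_notMem_tsupport fun hr' => hr (h3 (tsupport_deriv_subset hr'))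
    have hw := h.weak_form _ (isTestFunction_mul h1 h2 h3 hψ hψc)
    rw [← hw]
    congr 1
    · rw [← setIntegral_eq_integral_of_forall_compl_eq_zero (s := Ioo 0 T)
        (fun r hr => by rw [h0' r hr, zero_mul])]
      refine setIntegral_congr_fun measurableSet_Ioo fun r _ => ?_
      simp only
      rw [← integral_const_mul]
      refine integral_congr_ae (Eventually.of_forall fun x => ?_)
      simp only
      rw [deriv_mul_const (h1.differentiable (by norm_num) r)]
      ring
    · rw [← setIntegral_eq_integral_of_forall_compl_eq_zero (s := Ioo 0 T)
        (fun r hr => by rw [h0 r hr, zero_mul])]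
      refine setIntegral_congr_fun measurableSet_Ioo fun r _ => ?_
      simp only
      rw [← integral_const_mul]
      refine integral_congr_ae (Eventually.of_forall fun x => ?_)
      simp only
      rw [gradient_const_mul _ hψ, real_inner_smul_right]

/-- The conservation law may be tested with every function in the closure of `C¹(Ω̄)`. -/
theorem IsConserved.integral_sub (hT : 0 < T) (h : IsConserved Ω T a J) {ψ : Space → ℝ}
    {K : Space → Space} (hψ : IsC1Limit Ω ψ K) (s t : ℝ) :
    (∫ x in Ω, a t x * ψ x) - ∫ x in Ω, a s x * ψ x
      = ∫ r in s..t, ∫ x in Ω, inner ℝ (J (r, x)) (K x) := by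
  wlog hst : s ≤ t generalizing s t
  · have := this t s (le_of_not_ge hst)
    rw [intervalIntegral.integral_symm, ← this]
    ring
  obtain ⟨ψk, h1, h2, h3, h4, -⟩ := hψ.exists_seq
  have hψk := fun k => memLp_of_test (h1 k).continuous (h2 k) Ω
  have hKk := fun k => memLp_of_test (continuous_gradient (h1 k))
    (hasCompactSupport_gradient (h2 k)) Ω
  have tl : ∀ t, Tendsto (fun k => ∫ x in Ω, a t x * ψk k x) atTop (𝓝 (∫ x in Ω, a t x * ψ x)) := by
    intro t
    have := tendsto_integral_inner (h.memLp t) hψk hψ.memLp h3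
    simpa [mul_comm] using this
  set ν : Measure (ℝ × Space) := ((volume : Measure ℝ).restrict (Ioc s t)).prod (volume.restrict Ω)
    with hν
  have hνle : ν ≤ (volume : Measure ℝ).prod (volume.restrict Ω) := by
    rw [hν, ← Measure.restrict_univ (μ := volume.restrict Ω), Measure.prod_restrict,
      Measure.restrict_univ]
    exact Measure.restrict_le_self
  have hJν : MemLp J 2 ν := h.memLp_flux.mono_measure hνle
  have hr : ∀ {K : Space → Space}, MemLp K 2 (volume.restrict Ω) →
      ∫ r in s..t, ∫ x in Ω, inner ℝ (J (r, x)) (K x) = ∫ p, inner ℝ (J p) (K p.2) ∂ν := by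
    intro K hK
    rw [intervalIntegral.integral_of_le hst, hν,
      integral_prod _ ((h.integrable_inner_prod hK).mono_measure hνle)]
  have tr : Tendsto (fun k => ∫ r in s..t, ∫ x in Ω, inner ℝ (J (r, x)) (gradient (ψk k) x)) atTop
      (𝓝 (∫ r in s..t, ∫ x in Ω, inner ℝ (J (r, x)) (K x))) := by
    rw [hr hψ.memLp_gradient]
    simp only [fun k => hr (hKk k)]
    refine tendsto_integral_inner hJν (fun k => (hKk k).comp_snd _)
      (hψ.memLp_gradient.comp_snd _) ?_
    -- The fields are constant in time on the slab, so their space-time norm is the spatial norm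
    -- times the square root of its duration.
    have e : ∀ k, eLpNorm ((fun p : ℝ × Space => gradient (ψk k) p.2) - fun p => K p.2) 2 ν
        = (ENNReal.ofReal (t - s)) ^ (2⁻¹ : ℝ) *
          eLpNorm (gradient (ψk k) - K) 2 (volume.restrict Ω) := by
      intro k
      have hm : AEStronglyMeasurable (gradient (ψk k) - K) (Measure.map Prod.snd ν) := by
        rw [hν, Measure.map_snd_prod]
        exact ((hKk k).sub hψ.memLp_gradient).1.smul_measure _
      have := eLpNorm_map_measure (p := 2) hm measurable_snd.aemeasurable
      rw [hν, Measure.map_snd_prod, eLpNorm_smul_measure_of_ne_top (by norm_num)] at this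
      rw [hν]
      refine this.symm.trans ?_
      simp
    simp only [e]
    have := ENNReal.Tendsto.const_mul (a := (ENNReal.ofReal (t - s)) ^ (2⁻¹ : ℝ)) h4 (Or.inr
      (ENNReal.rpow_ne_top_of_nonneg (by norm_num) ENNReal.ofReal_ne_top))
    simpa using this
  refine tendsto_nhds_unique ((tl t).sub (tl s)) (tr.congr fun k => ?_)
  rw [h.integral_sub_of_test hT (h1 k) (h2 k)]

end

/-! ### Time correlations and the chain rule. -/

theorem measurePreserving_time_shift {X : Type*} [NormedAddCommGroup X] [MeasurableSpace X]
    [BorelSpace X] [SecondCountableTopology X] (μ : Measure X) [SFinite μ] [μ.IsAddLeftInvariant]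
    {e : ℝ → X} (he : Continuous e) (I : Set ℝ) :
    MeasurePreserving (fun z : ℝ × X => (z.1, e z.1 + z.2))
      (((volume : Measure ℝ).restrict I).prod μ) (((volume : Measure ℝ).restrict I).prod μ) := by
  refine (MeasurePreserving.id _).skew_product (g := fun s x => e s + x) ?_
    (Eventually.of_forall fun s => (measurePreserving_add_left μ (e s)).map_eq)
  exact (he.measurable.comp measurable_fst).add measurable_snd

instance isAddHaarMeasure_spaceTime : (volume : Measure (ℝ × Space)).IsAddHaarMeasure :=
  inferInstanceAs ((volume : Measure ℝ).prod (volume : Measure Space)).IsAddHaarMeasure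

section

variable {J K : ℝ × Space → Space}

/-- The correlation of two space-time fields at time lag `σ`. -/
noncomputable def timeCorrelation (J K : ℝ × Space → Space) (σ : ℝ) : ℝ :=
  ∫ t, ∫ x, inner ℝ (J (σ + t, x)) (K (t, x))

theorem memLp_translate (hJ : MemLp J 2 volume) (σ : ℝ) :
    MemLp (fun p : ℝ × Space => J (σ + p.1, p.2)) 2 volume := by
  have h : (fun p : ℝ × Space => J (σ + p.1, p.2)) = J ∘ fun p => (σ, (0 : Space)) + p := by
    ext1 p; simp [Prod.add_def]
  rw [h]
  exact hJ.comp_measurePreserving (measurePreserving_add_left volume (σ, (0 : Space)))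

theorem timeCorrelation_eq (hJ : MemLp J 2 volume) (hK : MemLp K 2 volume) (σ : ℝ) :
    timeCorrelation J K σ = ∫ p : ℝ × Space, inner ℝ (J (σ + p.1, p.2)) (K p) := by
  have := integrable_inner (memLp_translate hJ σ) hK
  rw [Measure.volume_eq_prod] at this ⊢
  rw [integral_prod _ this]
  rfl

theorem continuous_timeCorrelation (hJ : MemLp J 2 volume) (hK : MemLp K 2 volume) :
    Continuous (timeCorrelation J K) := by
  have h1 : Continuous fun σ : ℝ => inner ℝ (hK.toLp K)
      ((hJ.comp_measurePreserving (measurePreserving_add_left volume (σ, (0 : Space)))).toLp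
      (J ∘ ((σ, (0 : Space)) + ·))) :=
    continuous_const.inner ((continuous_translate_toLp hJ).comp (by fun_prop :
      Continuous fun σ : ℝ => (σ, (0 : Space))))
  refine h1.congr fun σ => ?_
  rw [timeCorrelation_eq hJ hK, L2.inner_def]
  refine integral_congr_ae ?_
  filter_upwards [hK.coeFn_toLp, (hJ.comp_measurePreserving
    (measurePreserving_add_left volume (σ, (0 : Space)))).coeFn_toLp] with p h1 h2
  rw [h1, h2, real_inner_comm]
  simp [Prod.add_def]

/-- The shear `(σ, t) ↦ (σ, σ + t)` preserves measure, so the shifted `J` is square integrable in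
all variables. `K` does not depend on the lag, which is why the lags range over a set of finite
measure. -/
theorem integrable_timeCorrelation_integrand (hJ : MemLp J 2 volume) (hK : MemLp K 2 volume)
    {I : Set ℝ} (hI : volume I ≠ ⊤) :
    Integrable (fun z : ℝ × ℝ => ∫ x, inner ℝ (J (z.1 + z.2, x)) (K (z.2, x)))
      (((volume : Measure ℝ).restrict I).prod volume) := by
  have : IsFiniteMeasure ((volume : Measure ℝ).restrict I) := isFiniteMeasure_restrict.2 hI
  set ν := ((volume : Measure ℝ).restrict I).prod (volume : Measure (ℝ × Space)) with hν
  have h1 : MemLp (fun z : ℝ × ℝ × Space => J (z.1 + z.2.1, z.2.2)) 2 ν := by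
    have := (hJ.comp_snd ((volume : Measure ℝ).restrict I)).comp_measurePreserving
      (measurePreserving_time_shift (volume : Measure (ℝ × Space))
        (e := fun σ => (σ, (0 : Space))) (by fun_prop) I)
    refine (memLp_congr_ae (Eventually.of_forall fun z => ?_)).1 this
    simp [Prod.add_def]
  have h2 : MemLp (fun z : ℝ × ℝ × Space => K z.2) 2 ν := hK.comp_snd _
  have h3 := integrable_inner h1 h2
  have h4 : MeasurePreserving (MeasurableEquiv.prodAssoc : (ℝ × ℝ) × Space ≃ᵐ ℝ × ℝ × Space)
      ((((volume : Measure ℝ).restrict I).prod (volume : Measure ℝ)).prod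
        (volume : Measure Space)) ν :=
    measurePreserving_prodAssoc _ _ _
  exact ((h4.integrable_comp_emb
    MeasurableEquiv.prodAssoc.measurableEmbedding).2 h3).integral_prod_left

theorem integral_timeCorrelation (hJ : MemLp J 2 volume) (hK : MemLp K 2 volume) (a b : ℝ) :
    Integrable (fun t => ∫ σ in a..b, ∫ x, inner ℝ (J (σ + t, x)) (K (t, x))) ∧
    ∫ σ in a..b, timeCorrelation J K σ
      = ∫ t, ∫ σ in a..b, ∫ x, inner ℝ (J (σ + t, x)) (K (t, x)) := by
  have h1 := integrable_timeCorrelation_integrand hJ hK (I := Ioc a b) (by simp)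
  have h2 := integrable_timeCorrelation_integrand hJ hK (I := Ioc b a) (by simp)
  refine ⟨h1.integral_prod_right.sub h2.integral_prod_right, ?_⟩
  simp only [intervalIntegral]
  rw [integral_sub h1.integral_prod_right h2.integral_prod_right]
  congr 1
  · exact integral_integral_swap h1
  · exact integral_integral_swap h2

end

/-- If the increments of `Φ` from almost every time dominate those of a linear functional tested
with `ψ t`, then `Φ` satisfies the chain rule. -/
theorem IsConserved.chain_rule {Ω : Set Space} (hΩ : MeasurableSet Ω) {T : ℝ} (hT : 0 < T)
    {a : ℝ → Space → ℝ} {J : ℝ × Space → Space} (h : IsConserved Ω T a J)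
    {ψ : ℝ → Space → ℝ} {K : ℝ × Space → Space}
    (hK : MemLp K 2 ((volume.restrict (Ioo 0 T)).prod (volume.restrict Ω)))
    (hψ : ∀ᵐ t ∂(volume.restrict (Ioo 0 T)), IsC1Limit Ω (ψ t) fun x => K (t, x))
    {Φ : ℝ → ℝ} (hΦ : Continuous Φ)
    (hle : ∀ᵐ t ∂(volume.restrict (Ioo 0 T)), ∀ s,
      (∫ x in Ω, a s x * ψ t x) - ∫ x in Ω, a t x * ψ t x ≤ Φ s - Φ t)
    {b : ℝ} (hb : b ∈ Ioc 0 T) :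
    Φ b - Φ 0 = ∫ t in Ioo 0 b, ∫ x in Ω, inner ℝ (J (t, x)) (K (t, x)) := by
  -- Only `K` is restricted to times in `(0, b)`. `J` must remain available at the shifted times `t
  -- + σ`.
  set J' : ℝ × Space → Space := (univ ×ˢ Ω).indicator J with hJ'
  set K' : ℝ × Space → Space := (Ioo 0 b ×ˢ Ω).indicator K with hK'
  have hJL : MemLp J' 2 volume := by
    rw [hJ', memLp_indicator_iff_restrict (MeasurableSet.univ.prod hΩ), Measure.volume_eq_prod,
      ← Measure.prod_restrict, Measure.restrict_univ]
    exact h.memLp_flux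
  have hKL : MemLp K' 2 volume := by
    rw [hK', memLp_indicator_iff_restrict (measurableSet_Ioo.prod hΩ), Measure.volume_eq_prod]
    refine hK.mono_measure ?_
    rw [Measure.prod_restrict]
    exact Measure.restrict_mono (prod_mono (Ioo_subset_Ioo_right hb.2) Subset.rfl) le_rfl
  have hinner : ∀ σ t, ∫ x, inner ℝ (J' (σ + t, x)) (K' (t, x)) =
      (Ioo 0 b).indicator (fun t => ∫ x in Ω, inner ℝ (J (σ + t, x)) (K (t, x))) t := by
    intro σ t
    by_cases ht : t ∈ Ioo 0 b
    · rw [indicator_of_mem ht, ← integral_indicator hΩ]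
      refine integral_congr_ae (Eventually.of_forall fun x => ?_)
      by_cases hx : x ∈ Ω
      · simp only [indicator_of_mem hx, hJ', hK']
        rw [indicator_of_mem (show (σ + t, x) ∈ univ ×ˢ Ω from ⟨trivial, hx⟩),
          indicator_of_mem (show (t, x) ∈ Ioo 0 b ×ˢ Ω from ⟨ht, hx⟩)]
      · simp only [indicator_of_notMem hx, hK']
        rw [indicator_of_notMem (show (t, x) ∉ Ioo 0 b ×ˢ Ω from fun h => hx h.2), inner_zero_right]
    · rw [indicator_of_notMem ht]
      simp only [hK']
      have h0 : ∀ x, (Ioo 0 b ×ˢ Ω).indicator K (t, x) = 0 := fun x =>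
        indicator_of_notMem (fun h => ht h.1) _
      simp [h0]
  set g := timeCorrelation J' K' with hg
  have hgc : Continuous g := continuous_timeCorrelation hJL hKL
  have hg0 : g 0 = ∫ t in Ioo 0 b, ∫ x in Ω, inner ℝ (J (t, x)) (K (t, x)) := by
    rw [hg, timeCorrelation, ← integral_indicator measurableSet_Ioo]
    refine integral_congr_ae (Eventually.of_forall fun t => ?_)
    simp only
    rw [hinner]
    simp only [zero_add]
  rw [← hg0]
  -- `Φ` is merely continuous. Averaging its increments over `t ∈ (0, b)` expresses them through the
  -- primitive `P`, which is differentiable.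
  set P : ℝ → ℝ := fun y => ∫ r in (0 : ℝ)..y, Φ r with hP
  have hPd : ∀ y, HasDerivAt P (Φ y) y := fun y =>
    intervalIntegral.integral_hasDerivAt_right (hΦ.intervalIntegrable _ _)
      (hΦ.stronglyMeasurableAtFilter _ _) hΦ.continuousAt
  have hΦi := fun a b => hΦ.intervalIntegrable (μ := volume) a b
  -- The hypothesis `hle` is applied between `t` and `t + τ` and integrated over `t ∈ (0, b)`. The
  -- increment of the pairing is a flux integral over the lags in `[0, τ]`, and Fubini gathers these
  -- into the correlation `g`. Times outside `[0, T]` are harmless because of the extensions.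
  have hineq : ∀ τ, ∫ σ in (0 : ℝ)..τ, g σ ≤ P (b + τ) - P τ - P b := by
    intro τ
    obtain ⟨hint, heq⟩ := integral_timeCorrelation hJL hKL 0 τ
    have hΦτ : Continuous fun t => Φ (τ + t) := hΦ.comp (by fun_prop)
    have e1 : P (b + τ) - P τ - P b = ∫ t in Ioo 0 b, (Φ (τ + t) - Φ t) := by
      rw [← integral_Ioc_eq_integral_Ioo, ← intervalIntegral.integral_of_le hb.1.le,
        intervalIntegral.integral_sub (hΦτ.intervalIntegrable _ _) (hΦi _ _),
        intervalIntegral.integral_comp_add_left Φ τ, add_zero,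
        intervalIntegral.integral_interval_sub_left (hΦi _ _) (hΦi _ _), add_comm τ b]
    rw [e1, hg, heq, ← integral_indicator measurableSet_Ioo]
    refine integral_mono_ae hint ?_ ?_
    · rw [integrable_indicator_iff measurableSet_Ioo]
      have hc : Continuous fun t => Φ (τ + t) - Φ t := hΦτ.sub hΦ
      exact (hc.integrableOn_Icc (a := 0) (b := b)).mono_set Ioo_subset_Icc_self
    · have hψ' := (ae_restrict_iff' measurableSet_Ioo).1 hψ
      have hle' := (ae_restrict_iff' measurableSet_Ioo).1 hle
      filter_upwards [hψ', hle'] with t h1 h2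
      simp only [hinner]
      by_cases ht : t ∈ Ioo 0 b
      · have htT : t ∈ Ioo 0 T := Ioo_subset_Ioo_right hb.2 ht
        simp only [indicator_of_mem ht]
        have h3 := h.integral_sub hT (h1 htT) t (τ + t)
        rw [intervalIntegral.integral_comp_add_right
            (fun r => ∫ x in Ω, inner ℝ (J (r, x)) (K (t, x))),
          zero_add, ← h3]
        exact h2 htT (τ + t)
      · simp [indicator_of_notMem ht]
  have hd : HasDerivAt (fun τ => P (b + τ) - P τ - P b - ∫ σ in (0 : ℝ)..τ, g σ)
      (Φ b - Φ 0 - g 0) 0 := by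
    have d1 : HasDerivAt (fun τ => P (b + τ)) (Φ b) 0 := by
      have := (hPd (b + 0)).comp_const_add b 0
      simpa using this
    have d2 : HasDerivAt (fun τ => ∫ σ in (0 : ℝ)..τ, g σ) (g 0) 0 :=
      intervalIntegral.integral_hasDerivAt_right (hgc.intervalIntegrable _ _)
        (hgc.stronglyMeasurableAtFilter _ _) hgc.continuousAt
    exact ((d1.sub (hPd 0)).sub_const _).sub d2
  -- The difference is nonnegative for lags of both signs and vanishes at lag zero, so its
  -- derivative vanishes there. This turns the one-sided inequality into an equality.
  have hmin : IsLocalMin (fun τ => P (b + τ) - P τ - P b - ∫ σ in (0 : ℝ)..τ, g σ) 0 := by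
    refine Eventually.of_forall fun τ => ?_
    have := hineq τ
    simp only [add_zero, intervalIntegral.integral_same, hP] at this ⊢
    linarith
  have := hmin.hasDerivAt_eq_zero hd
  linarith

/-! ### Algebra of the friction system. -/

section Friction

variable {n : ℕ} {D : Fin n → Fin n → ℝ} {a : Fin n → ℝ} {m G : Fin n → Space}

/-- The off-diagonal friction coefficients `1 / D i j`. -/
noncomputable def frictionCoeff (D : Fin n → Fin n → ℝ) (i j : Fin n) : ℝ :=
  if i = j then 0 else (D i j)⁻¹

theorem frictionCoeff_symm (hD : IsDiffusivity D) (i j : Fin n) :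
    frictionCoeff D i j = frictionCoeff D j i := by
  simp only [frictionCoeff, hD.symm i j, eq_comm]

/-- Each part of the diagonal entry pairs with an off-diagonal one, so that only the differences
`√a_j m_i - √a_i m_j` occur, as symmetrisation requires. -/
theorem sum_frictionMatrix_smul (D : Fin n → Fin n → ℝ) (ha : ∀ i, 0 ≤ a i) (m : Fin n → Space)
    (i : Fin n) : ∑ j, frictionMatrix D a i j • m j =
      ∑ j, (frictionCoeff D i j * √(a j)) • (√(a j) • m i - √(a i) • m j) := by
  rw [← Finset.add_sum_erase _ _ (Finset.mem_univ i),
    ← Finset.add_sum_erase _ _ (Finset.mem_univ i)]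
  simp only [frictionCoeff, frictionMatrix, if_true, zero_mul, zero_smul, zero_add]
  rw [Finset.sum_smul, ← Finset.sum_add_distrib]
  refine Finset.sum_congr rfl fun j hj => ?_
  have hij : i ≠ j := (Finset.ne_of_mem_erase hj).symm
  rw [if_neg hij, if_neg hij, smul_sub, smul_smul, smul_smul, sub_eq_add_neg, ← neg_smul,
    Real.sqrt_mul (ha i)]
  congr 2
  · rw [mul_assoc, Real.mul_self_sqrt (ha j)]
    ring
  · ring

/-- Symmetrisation of the quadratic form of the friction matrix. -/
theorem sum_inner_friction {e : Fin n → Fin n → ℝ} (he : ∀ i j, e i j = e j i) (s : Fin n → ℝ)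
    (m : Fin n → Space) :
    ∑ i, inner ℝ (m i) (∑ j, (e i j * s j) • (s j • m i - s i • m j)) =
      1 / 2 * ∑ i, ∑ j, e i j * ‖s j • m i - s i • m j‖ ^ 2 := by
  have h1 : ∑ i, inner ℝ (m i) (∑ j, (e i j * s j) • (s j • m i - s i • m j)) =
      ∑ i, ∑ j, e i j * inner ℝ (s j • m i) (s j • m i - s i • m j) := by
    refine Finset.sum_congr rfl fun i _ => ?_
    rw [inner_sum]
    refine Finset.sum_congr rfl fun j _ => ?_
    rw [real_inner_smul_right, real_inner_smul_left]
    ring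
  have h2 : ∑ i, ∑ j, e i j * inner ℝ (s j • m i) (s j • m i - s i • m j) =
      ∑ i, ∑ j, e i j * inner ℝ (s i • m j) (s i • m j - s j • m i) := by
    rw [Finset.sum_comm]
    refine Finset.sum_congr rfl fun i _ => Finset.sum_congr rfl fun j _ => ?_
    rw [he j i]
  have h3 : ∑ i, ∑ j, e i j * ‖s j • m i - s i • m j‖ ^ 2 =
      (∑ i, ∑ j, e i j * inner ℝ (s j • m i) (s j • m i - s i • m j)) +
      ∑ i, ∑ j, e i j * inner ℝ (s i • m j) (s i • m j - s j • m i) := by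
    simp only [← Finset.sum_add_distrib]
    refine Finset.sum_congr rfl fun i _ => Finset.sum_congr rfl fun j _ => ?_
    rw [← mul_add, ← real_inner_self_eq_norm_sq]
    simp only [inner_sub_left, inner_sub_right]
    ring
  rw [h1, h3, ← h2]
  ring

/-- This is the symmetrised form with all coefficients equal to one. For them the friction operator
is the projection orthogonal to `s`, which fixes `m` by the constraint. -/
theorem sum_norm_sq_eq {s : Fin n → ℝ} (hs : ∑ i, s i ^ 2 = 1) {m : Fin n → Space}
    (hm : ∑ i, s i • m i = 0) :
    ∑ i, ‖m i‖ ^ 2 = 1 / 2 * ∑ i, ∑ j, ‖s j • m i - s i • m j‖ ^ 2 := by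
  have h1 := sum_inner_friction (e := fun _ _ => 1) (fun _ _ => rfl) s m
  simp only [one_mul] at h1
  rw [← h1]
  refine Finset.sum_congr rfl fun i _ => ?_
  have h2 : ∑ j, s j • (s j • m i - s i • m j) = m i := by
    simp only [smul_sub, smul_smul, Finset.sum_sub_distrib, ← Finset.sum_smul]
    have h3 : ∑ j, (s j * s i) • m j = s i • ∑ j, s j • m j := by
      rw [Finset.smul_sum]
      exact Finset.sum_congr rfl fun j _ => by rw [smul_smul, mul_comm]
    rw [h3, hm, smul_zero, sub_zero]
    simp only [← pow_two, hs, one_smul]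
  rw [h2, real_inner_self_eq_norm_sq]

theorem exists_frictionCoeff_lower_bound (hD : IsDiffusivity D) :
    ∃ κ : ℝ, 0 < κ ∧ ∀ i j, i ≠ j → κ ≤ frictionCoeff D i j := by
  have hS : 0 ≤ ∑ i, ∑ j, |D i j| :=
    Finset.sum_nonneg fun i _ => Finset.sum_nonneg fun j _ => abs_nonneg _
  refine ⟨(1 + ∑ i, ∑ j, |D i j|)⁻¹, by positivity, fun i j hij => ?_⟩
  rw [frictionCoeff, if_neg hij]
  refine inv_anti₀ (hD.pos i j hij) ?_
  have h1 : |D i j| ≤ ∑ j, |D i j| :=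
    Finset.single_le_sum (f := fun j => |D i j|) (fun j _ => abs_nonneg _) (Finset.mem_univ j)
  have h2 : ∑ j, |D i j| ≤ ∑ i, ∑ j, |D i j| :=
    Finset.single_le_sum (f := fun i => ∑ j, |D i j|)
      (fun i _ => Finset.sum_nonneg fun j _ => abs_nonneg _) (Finset.mem_univ i)
  linarith [le_abs_self (D i j)]

/-- The friction matrix is coercive on the orthogonal complement of `√a`. -/
theorem sum_norm_sq_le_of_friction (hD : IsDiffusivity D) {κ : ℝ} (hκ : 0 < κ)
    (hκD : ∀ i j, i ≠ j → κ ≤ frictionCoeff D i j) (ha : ∀ i, 0 ≤ a i) (ha1 : ∑ i, a i = 1)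
    (hsys : ∀ i, -∑ j, frictionMatrix D a i j • m j = (2 : ℝ) • G i)
    (hm : ∑ i, √(a i) • m i = 0) :
    ∑ i, ‖m i‖ ^ 2 ≤ 4 / κ ^ 2 * ∑ i, ‖G i‖ ^ 2 := by
  have h1 := sum_norm_sq_eq (s := fun i => √(a i)) (by simpa [Real.sq_sqrt (ha _)] using ha1) hm
  have h2 := sum_inner_friction (frictionCoeff_symm hD) (fun i => √(a i)) m
  simp only [← sum_frictionMatrix_smul D ha] at h2
  have h3 : ∀ i, ∑ j, frictionMatrix D a i j • m j = -((2 : ℝ) • G i) := fun i => by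
    rw [← hsys i, neg_neg]
  have h4 : κ * ∑ i, ‖m i‖ ^ 2 ≤
      ∑ i, inner ℝ (m i) (∑ j, frictionMatrix D a i j • m j) := by
    rw [h1, h2, mul_left_comm, Finset.mul_sum]
    refine mul_le_mul_of_nonneg_left (Finset.sum_le_sum fun i _ => ?_) (by norm_num)
    rw [Finset.mul_sum]
    refine Finset.sum_le_sum fun j _ => ?_
    by_cases hij : i = j
    · subst hij
      simp
    · exact mul_le_mul_of_nonneg_right (hκD i j hij) (by positivity)
  have h5 : ∑ i, inner ℝ (m i) (∑ j, frictionMatrix D a i j • m j) ≤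
      ∑ i, (κ / 2 * ‖m i‖ ^ 2 + 2 / κ * ‖G i‖ ^ 2) := by
    refine Finset.sum_le_sum fun i _ => ?_
    rw [h3 i, inner_neg_right, real_inner_smul_right]
    have h6 := abs_real_inner_le_norm (m i) (G i)
    have h7 := neg_abs_le (inner ℝ (m i) (G i))
    -- Young's inequality, weighted so that half of the coercive term absorbs the `m` contribution.
    have h8 : 0 ≤ (κ * ‖m i‖ - 2 * ‖G i‖) ^ 2 / (2 * κ) := by positivity
    have h9 : (κ * ‖m i‖ - 2 * ‖G i‖) ^ 2 / (2 * κ) =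
        κ / 2 * ‖m i‖ ^ 2 + 2 / κ * ‖G i‖ ^ 2 - 2 * (‖m i‖ * ‖G i‖) := by
      field_simp
      ring
    linarith
  rw [Finset.sum_add_distrib, ← Finset.mul_sum, ← Finset.mul_sum] at h5
  have h10 : ∑ i, ‖m i‖ ^ 2 ≤ (2 / κ) * (2 / κ * ∑ i, ‖G i‖ ^ 2) := by
    rw [div_mul_eq_mul_div, le_div_iff₀ hκ]
    linarith
  calc _ ≤ _ := h10
    _ = _ := by ring

/-- The entropy production equals the dissipation: only components that are present count. -/
theorem sum_inner_eq_dissipation (hD : IsDiffusivity D) {c : Fin n → ℝ → Space → ℝ}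
    {m G : Fin n → ℝ → Space → Space} {t : ℝ} {x : Space} (hc : ∀ i, 0 ≤ c i t x)
    (hsys : ∀ i, -∑ j, frictionMatrix D (fun k => c k t x) i j • m j t x = (2 : ℝ) • G i t x) :
    ∑ i, (if 0 < c i t x then 2 * inner ℝ (m i t x) (G i t x) else 0) =
      -(1 / 2 * ∑ i, ∑ j, dissipation D c m i j t x) := by
  classical
  set a : Fin n → ℝ := fun k => c k t x with ha
  -- On vacuum `m i` may be nonzero although `u i` is meaningless, so it is discarded. Rows with `a
  -- i > 0` are unaffected, since there `m j` enters only through `√(a j) • m j`.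
  set m' : Fin n → Space := fun i => if 0 < a i then m i t x else 0 with hm'
  have hzero : ∀ i, ¬ 0 < a i → a i = 0 := fun i hi => le_antisymm (not_lt.1 hi) (hc i)
  have hsm : ∀ i, √(a i) • m' i = √(a i) • m i t x := by
    intro i
    by_cases hi : 0 < a i
    · simp only [hm', if_pos hi]
    · simp [hzero i hi]
  have h1 := sum_inner_friction (frictionCoeff_symm hD) (fun i => √(a i)) m'
  have h2 : ∀ i, (if 0 < c i t x then 2 * inner ℝ (m i t x) (G i t x) else 0) =
      -inner ℝ (m' i) (∑ j, (frictionCoeff D i j * √(a j)) • (√(a j) • m' i - √(a i) • m' j)) := by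
    intro i
    by_cases hi : 0 < a i
    · have h3 : ∑ j, (frictionCoeff D i j * √(a j)) • (√(a j) • m' i - √(a i) • m' j) =
          ∑ j, (frictionCoeff D i j * √(a j)) • (√(a j) • m i t x - √(a i) • m j t x) := by
        refine Finset.sum_congr rfl fun j _ => ?_
        have e1 : m' i = m i t x := by simp only [hm', if_pos hi]
        have e2 : ∀ y : Space, (frictionCoeff D i j * √(a j)) • √(a i) • y =
            (frictionCoeff D i j * √(a i)) • √(a j) • y := fun y => by
          rw [smul_smul, smul_smul, mul_right_comm]
        rw [smul_sub, smul_sub, e1, e2, e2, hsm j]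
      have h4 := hsys i
      rw [sum_frictionMatrix_smul D hc] at h4
      rw [if_pos hi, h3, ← inner_neg_right, h4, real_inner_smul_right]
      simp only [hm', if_pos hi]
    · have hi' : ¬ 0 < c i t x := hi
      rw [if_neg hi']
      simp [hm', if_neg hi]
  have h5 : ∀ i j, frictionCoeff D i j * ‖√(a j) • m' i - √(a i) • m' j‖ ^ 2 =
      dissipation D c m i j t x := by
    intro i j
    unfold dissipation frictionCoeff velocity
    by_cases hij : i = j
    · subst hij
      simp
    rw [if_neg hij]
    by_cases hi : 0 < a i
    swap
    · have : c i t x = 0 := hzero i hi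
      simp [hm', if_neg hi, this, hzero i hi]
    by_cases hj : 0 < a j
    swap
    · have : c j t x = 0 := hzero j hj
      simp [hm', if_neg hj, this, hzero j hj]
    have h6 : √(a j) • m' i - √(a i) • m' j =
        (√(a i) * √(a j)) • ((√(c i t x))⁻¹ • m i t x - (√(c j t x))⁻¹ • m j t x) := by
      have hi0 : √(a i) ≠ 0 := (Real.sqrt_pos.2 hi).ne'
      have hj0 : √(a j) ≠ 0 := (Real.sqrt_pos.2 hj).ne'
      change _ = (√(a i) * √(a j)) • ((√(a i))⁻¹ • m i t x - (√(a j))⁻¹ • m j t x)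
      rw [smul_sub, smul_smul, smul_smul, mul_inv_cancel_right₀ hj0, mul_comm √(a i),
        mul_inv_cancel_right₀ hi0]
      simp only [hm', if_pos hi, if_pos hj]
    rw [h6, norm_smul, mul_pow, Real.norm_eq_abs, sq_abs, mul_pow, Real.sq_sqrt hi.le,
      Real.sq_sqrt hj.le]
    change _ = a i * a j / D i j * _
    ring
  simp only [h5] at h1
  rw [← h1, ← Finset.sum_neg_distrib]
  exact Finset.sum_congr rfl fun i _ => h2 i

theorem dissipation_nonneg (hD : IsDiffusivity D) {c : Fin n → ℝ → Space → ℝ}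
    {m : Fin n → ℝ → Space → Space} {t : ℝ} {x : Space} (hc : ∀ i, 0 ≤ c i t x) (i j : Fin n) :
    0 ≤ dissipation D c m i j t x := by
  unfold dissipation
  by_cases hij : i = j
  · subst hij
    simp
  · have := hD.pos i j hij
    have := hc i
    have := hc j
    positivity

end Friction

/-! ### The regularised entropy and its derivative. -/

section Regularised

variable {δ : ℝ}

/-- A regularisation of `y ln y - y`, up to affine terms; its derivative is `ln (1 + y / δ)`. -/
noncomputable def regEntropy (δ y : ℝ) : ℝ := (y + δ) * Real.log (1 + y / δ) - y

/-- The derivative of the regularised entropy as a function of the square root of the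
concentration. -/
noncomputable def regPotential (δ w : ℝ) : ℝ := Real.log (1 + w ^ 2 / δ)

theorem regEntropy_zero (δ : ℝ) : regEntropy δ 0 = 0 := by simp [regEntropy]

theorem measurable_regEntropy (δ : ℝ) : Measurable (regEntropy δ) := by
  unfold regEntropy
  fun_prop

/-- Convexity of `regEntropy δ`, in the form of its supporting line at `y`. It reduces to `1 - 1 / q
≤ ln q` for `q = (z + δ) / (y + δ)`. -/
theorem le_regEntropy_sub (hδ : 0 < δ) {y z : ℝ} (hy : 0 ≤ y) (hz : 0 ≤ z) :
    (z - y) * Real.log (1 + y / δ) ≤ regEntropy δ z - regEntropy δ y := by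
  have e : ∀ y, 0 ≤ y → Real.log (1 + y / δ) = Real.log (y + δ) - Real.log δ := by
    intro y hy
    rw [← Real.log_div (by positivity) hδ.ne']
    congr 1
    field_simp
    ring
  have h1 : 1 - ((z + δ) / (y + δ))⁻¹ ≤ Real.log ((z + δ) / (y + δ)) :=
    Real.one_sub_inv_le_log_of_pos (by positivity)
  rw [Real.log_div (by positivity) (by positivity), inv_div] at h1
  have h2 := mul_le_mul_of_nonneg_left h1 (show 0 ≤ z + δ by positivity)
  rw [mul_sub, mul_one, mul_div_cancel₀ _ (show z + δ ≠ 0 by positivity)] at h2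
  unfold regEntropy
  rw [e y hy, e z hz]
  nlinarith

/-- The supporting lines at `y` and at `z` bound the increment from both sides, and the slopes on
`[0, 1]` lie between `0` and `ln (1 + 1 / δ)`. -/
theorem abs_regEntropy_sub_le (hδ : 0 < δ) {y z : ℝ} (hy : y ∈ Icc (0 : ℝ) 1)
    (hz : z ∈ Icc (0 : ℝ) 1) :
    |regEntropy δ z - regEntropy δ y| ≤ Real.log (1 + 1 / δ) * |z - y| := by
  have hL : ∀ y ∈ Icc (0 : ℝ) 1, 0 ≤ Real.log (1 + y / δ) ∧
      Real.log (1 + y / δ) ≤ Real.log (1 + 1 / δ) := by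
    intro y hy
    have h0 : 0 ≤ y / δ := div_nonneg hy.1 hδ.le
    refine ⟨Real.log_nonneg (by linarith), Real.log_le_log (by linarith) ?_⟩
    have := hy.2
    gcongr
  have h1 := le_regEntropy_sub hδ hy.1 hz.1
  have h2 := le_regEntropy_sub hδ hz.1 hy.1
  obtain ⟨a1, a2⟩ := hL y hy
  obtain ⟨b1, b2⟩ := hL z hz
  rcases le_total y z with h | h
  · rw [abs_of_nonneg (sub_nonneg.2 h), abs_le]
    constructor <;> nlinarith
  · rw [abs_of_nonpos (sub_nonpos.2 h), abs_le]
    constructor <;> nlinarith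

theorem contDiff_regPotential (hδ : 0 < δ) : ContDiff ℝ 1 (regPotential δ) := by
  unfold regPotential
  refine ContDiff.log (by fun_prop) fun w => ?_
  positivity

theorem deriv_regPotential (hδ : 0 < δ) (w : ℝ) :
    deriv (regPotential δ) w = 2 * w / (w ^ 2 + δ) := by
  have h1 : HasDerivAt (fun w : ℝ => 1 + w ^ 2 / δ) (2 * w / δ) w := by
    have := ((hasDerivAt_pow 2 w).div_const δ).const_add 1
    simpa using this
  have h2 := (h1.log (by positivity)).deriv
  unfold regPotential
  rw [h2]
  field_simp
  ring

/-- A crude bound, from `2 |w| ≤ w ^ 2 + 1`. Any finite bound for fixed `δ` makes the potential of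
`√c` an admissible test function. -/
theorem abs_deriv_regPotential_le (hδ : 0 < δ) (w : ℝ) :
    |deriv (regPotential δ) w| ≤ 1 + 1 / δ := by
  rw [deriv_regPotential hδ, abs_div, abs_of_pos (show 0 < w ^ 2 + δ by positivity),
    div_le_iff₀ (by positivity), abs_mul, abs_two]
  have h1 : (1 + 1 / δ) * (w ^ 2 + δ) = w ^ 2 + δ + w ^ 2 / δ + 1 := by
    field_simp
    ring
  have h2 : 0 ≤ w ^ 2 / δ := by positivity
  rw [h1]
  nlinarith [sq_nonneg (|w| - 1), sq_abs w]

end Regularised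

/-! ### Bounds at every time and the balance of the regularised entropy. -/

section Conserved

variable {Ω : Set Space} {T : ℝ} {a : ℝ → Space → ℝ} {J : ℝ × Space → Space}

/-- This transfers properties from almost every time to every time: a set of full measure in `(0,
T)` meets every neighbourhood of `t`, where `Y` is small. -/
theorem le_zero_of_ae_le {T : ℝ} (hT : 0 < T) {X : ℝ≥0∞} {Y : ℝ → ℝ≥0∞} {t : ℝ}
    (ht : t ∈ Icc 0 T) (hY : Tendsto Y (𝓝 t) (𝓝 0))
    (h : ∀ᵐ s ∂(volume.restrict (Ioo 0 T)), X ≤ Y s) : X = 0 := by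
  by_contra hX
  obtain ⟨U, hU, hUo, htU⟩ :=
    eventually_nhds_iff.1 (hY.eventually (gt_mem_nhds (pos_iff_ne_zero.2 hX)))
  rw [← closure_Ioo hT.ne] at ht
  have hne : (U ∩ Ioo 0 T).Nonempty := mem_closure_iff.1 ht U hUo htU
  have hpos := (hUo.inter isOpen_Ioo).measure_pos volume hne
  have h' := (ae_restrict_iff' measurableSet_Ioo).1 h
  refine hpos.ne' (measure_mono_null (fun s hs => ?_) h')
  simp only [mem_compl_iff, mem_ofPred_eq, not_forall, not_le]
  exact ⟨hs.2, hU s hs.1⟩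

theorem IsConserved.nonneg (hT : 0 < T) (h : IsConserved Ω T a J)
    (h0 : ∀ᵐ s ∂(volume.restrict (Ioo 0 T)), ∀ᵐ x ∂(volume.restrict Ω), 0 ≤ a s x) (t : ℝ) :
    ∀ᵐ x ∂(volume.restrict Ω), 0 ≤ a t x := by
  rw [h.clamp_eq t]
  -- The negative part at the given time is dominated pointwise by the distance to any nonnegative
  -- `a s`.
  have hz : eLpNorm (fun x => min (a (clamp T t) x) 0) 2 (volume.restrict Ω) = 0 := by
    refine le_zero_of_ae_le hT (clamp_mem hT.le t) (h.continuous (clamp T t)) ?_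
    filter_upwards [h0] with s hs
    refine eLpNorm_mono_ae ?_
    filter_upwards [hs] with x hx
    simp only [Real.norm_eq_abs, Pi.sub_apply]
    rcases le_total (a (clamp T t) x) 0 with h1 | h1
    · rw [min_eq_left h1, abs_of_nonpos h1]
      exact le_trans (by linarith) (le_abs_self _)
    · rw [min_eq_right h1, abs_zero]
      exact abs_nonneg _
  have hm : AEStronglyMeasurable (fun x => min (a (clamp T t) x) 0) (volume.restrict Ω) :=
    (h.memLp _).1.inf aestronglyMeasurable_const
  rw [eLpNorm_eq_zero_iff hm (by norm_num)] at hz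
  filter_upwards [hz] with x hx
  exact min_eq_right_iff.1 hx

theorem sum_eq_one_of_conserved {n : ℕ} {a : Fin n → ℝ → Space → ℝ} {J : Fin n → ℝ × Space → Space}
    (hΩ : volume Ω ≠ ⊤) (hT : 0 < T) (h : ∀ i, IsConserved Ω T (a i) (J i))
    (h0 : ∀ᵐ s ∂(volume.restrict (Ioo 0 T)), ∀ᵐ x ∂(volume.restrict Ω), ∑ i, a i s x = 1) (t : ℝ) :
    ∀ᵐ x ∂(volume.restrict Ω), ∑ i, a i t x = 1 := by
  have hfin : IsFiniteMeasure (volume.restrict Ω) := isFiniteMeasure_restrict.2 hΩ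
  simp only [fun i => (h i).clamp_eq t]
  set τ := clamp T t
  have hsum : Tendsto (fun s => ∑ i, eLpNorm (a i s - a i τ) 2 (volume.restrict Ω)) (𝓝 τ)
      (𝓝 0) := by
    have := tendsto_finsetSum Finset.univ fun i _ => (h i).continuous τ
    simpa using this
  have hmem : MemLp (fun x => 1 - ∑ i, a i τ x) 2 (volume.restrict Ω) :=
    (memLp_const 1).sub (memLp_finsetSum _ fun i _ => (h i).memLp τ)
  have hz : eLpNorm (fun x => 1 - ∑ i, a i τ x) 2 (volume.restrict Ω) = 0 := by
    refine le_zero_of_ae_le hT (clamp_mem hT.le t) hsum ?_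
    filter_upwards [h0] with s hs
    refine le_trans (le_of_eq ?_) (eLpNorm_sum_le (f := fun i => a i s - a i τ)
      (fun i _ => (((h i).memLp s).sub ((h i).memLp τ)).1) (by norm_num))
    refine eLpNorm_congr_ae ?_
    filter_upwards [hs] with x hx
    simp only [Finset.sum_apply, Pi.sub_apply, Finset.sum_sub_distrib, hx]
  rw [eLpNorm_eq_zero_iff hmem.1 (by norm_num)] at hz
  filter_upwards [hz] with x hx
  exact (sub_eq_zero.1 hx).symm

theorem integrable_regEntropy {μ : Measure Space} [IsFiniteMeasure μ] {δ : ℝ} (hδ : 0 < δ)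
    {f : Space → ℝ} (hf : AEStronglyMeasurable f μ) (h01 : ∀ᵐ x ∂μ, f x ∈ Icc (0 : ℝ) 1) :
    Integrable (fun x => regEntropy δ (f x)) μ := by
  refine Integrable.of_bound (C := Real.log (1 + 1 / δ))
    ((measurable_regEntropy δ).comp_aemeasurable hf.aemeasurable).aestronglyMeasurable ?_
  filter_upwards [h01] with x hx
  have h1 := abs_regEntropy_sub_le hδ ⟨le_rfl, zero_le_one⟩ hx
  rw [regEntropy_zero, sub_zero, sub_zero, abs_of_nonneg hx.1] at h1
  refine h1.trans (mul_le_of_le_one_right (Real.log_nonneg ?_) hx.2)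
  have : 0 < 1 / δ := by positivity
  linarith

/-- `regEntropy δ` is Lipschitz on `[0, 1]`, and `L²` convergence implies `L¹` convergence on a set
of finite measure. -/
theorem IsConserved.continuous_regEntropy (hΩ : volume Ω ≠ ⊤) (h : IsConserved Ω T a J)
    (h01 : ∀ t, ∀ᵐ x ∂(volume.restrict Ω), a t x ∈ Icc (0 : ℝ) 1) {δ : ℝ} (hδ : 0 < δ) :
    Continuous fun t => ∫ x in Ω, regEntropy δ (a t x) := by
  have hfin : IsFiniteMeasure (volume.restrict Ω) := isFiniteMeasure_restrict.2 hΩ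
  have hi := fun t => integrable_regEntropy hδ (h.memLp t).1 (h01 t)
  refine continuous_iff_continuousAt.2 fun t => ?_
  refine tendsto_integral_of_L1' _ (hi t).1 (Eventually.of_forall hi) ?_
  set L := Real.log (1 + 1 / δ)
  set C : ℝ≥0∞ := volume.restrict Ω univ ^ (1 / (1 : ℝ≥0∞).toReal - 1 / (2 : ℝ≥0∞).toReal) with hC
  have hCt : C ≠ ⊤ := by
    rw [hC]
    exact ENNReal.rpow_ne_top_of_nonneg (by norm_num) (measure_ne_top _ _)
  have hlim : Tendsto (fun s => ENNReal.ofReal L * eLpNorm (a s - a t) 2 (volume.restrict Ω) * C)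
      (𝓝 t) (𝓝 0) := by
    have h1 := ENNReal.Tendsto.const_mul (a := ENNReal.ofReal L) (h.continuous t)
      (Or.inr ENNReal.ofReal_ne_top)
    have h2 := ENNReal.Tendsto.mul_const (b := C) h1 (Or.inr hCt)
    simpa using h2
  refine tendsto_of_tendsto_of_tendsto_of_le_of_le tendsto_const_nhds hlim (fun _ => bot_le)
    fun s => ?_
  refine (eLpNorm_le_eLpNorm_mul_rpow_measure_univ (p := 1) (q := 2) (by norm_num)
    ((hi s).1.sub (hi t).1)).trans ?_
  gcongr
  refine eLpNorm_le_mul_eLpNorm_of_ae_le_mul ?_ 2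
  filter_upwards [h01 s, h01 t] with x h1 h2
  exact abs_regEntropy_sub_le hδ h2 h1

/-- Balance of the regularised entropy of a single component. -/
theorem IsConserved.regEntropy_balance (hΩ : IsBoundedSmoothDomain Ω) (hT : 0 < T)
    (h : IsConserved Ω T a J)
    (h01 : ∀ t, ∀ᵐ x ∂(volume.restrict Ω), a t x ∈ Icc (0 : ℝ) 1) {G : ℝ → Space → Space}
    (hG : HasL2H1Gradient Ω T (fun t x => √(a t x)) G) {δ : ℝ} (hδ : 0 < δ) {b : ℝ}
    (hb : b ∈ Ioc 0 T) :
    (∫ x in Ω, regEntropy δ (a b x)) - ∫ x in Ω, regEntropy δ (a 0 x) =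
      ∫ t in Ioo 0 b, ∫ x in Ω,
        inner ℝ (J (t, x)) (deriv (regPotential δ) √(a t x) • G t x) := by
  have hΩv : volume Ω ≠ ⊤ := hΩ.isBounded.measure_lt_top.ne
  have hfin : IsFiniteMeasure (volume.restrict Ω) := isFiniteMeasure_restrict.2 hΩv
  have hcd := contDiff_regPotential hδ
  have hlim : ∀ᵐ t ∂(volume.restrict (Ioo 0 T)), IsC1Limit Ω (fun x => regPotential δ √(a t x))
      fun x => deriv (regPotential δ) √(a t x) • G t x := by
    filter_upwards [hG.ae_gradient] with t ht
    exact (hΩ.isC1Limit ht).comp hcd (by simp [regPotential]) (abs_deriv_regPotential_le hδ)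
  refine h.chain_rule hΩ.isOpen.measurableSet hT
    (ψ := fun t x => regPotential δ √(a t x))
    (K := fun p => deriv (regPotential δ) √(a p.1 p.2) • G p.1 p.2) ?_ hlim
    (h.continuous_regEntropy hΩv h01 hδ) ?_ hb
  · refine hG.memLp_gradient.of_le_mul (c := 1 + 1 / δ)
      (((hcd.continuous_deriv (by norm_num)).comp_aestronglyMeasurable hG.memLp.1).smul
        hG.memLp_gradient.1) (Eventually.of_forall fun p => ?_)
    rw [norm_smul]
    exact mul_le_mul_of_nonneg_right (abs_deriv_regPotential_le hδ _) (norm_nonneg _)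
  -- The one-sided hypothesis of the chain rule is the convexity of `regEntropy δ`, integrated over
  -- `Ω`.
  · filter_upwards [hlim] with t ht s
    have hi : ∀ s, Integrable (fun x => a s x * regPotential δ √(a t x)) (volume.restrict Ω) :=
      fun s => (h.memLp s).integrable_mul ht.memLp
    rw [← MeasureTheory.integral_sub (hi s) (hi t), ← MeasureTheory.integral_sub
      (integrable_regEntropy hδ (h.memLp s).1 (h01 s))
      (integrable_regEntropy hδ (h.memLp t).1 (h01 t))]
    refine integral_mono_ae ((hi s).sub (hi t))
      ((integrable_regEntropy hδ (h.memLp s).1 (h01 s)).sub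
      (integrable_regEntropy hδ (h.memLp t).1 (h01 t))) ?_
    filter_upwards [h01 s, h01 t] with x hs ht
    have := le_regEntropy_sub hδ ht.1 hs.1
    simp only [regPotential, Real.sq_sqrt ht.1]
    linarith

end Conserved

/-! ### The limit `δ → 0`. -/

section Limit

/-- The entropy density evaluated with a shifted logarithm. -/
noncomputable def shiftedEntropy (δ y : ℝ) : ℝ := (y + δ) * Real.log (y + δ) - y

theorem entropyDensity_eq (y : ℝ) : entropyDensity y = shiftedEntropy 0 y := by
  simp only [entropyDensity, shiftedEntropy, add_zero]
  ring

theorem continuous_shiftedEntropy : Continuous fun p : ℝ × ℝ => shiftedEntropy p.1 p.2 := by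
  unfold shiftedEntropy
  exact (Real.continuous_mul_log.comp (continuous_snd.add continuous_fst)).sub continuous_snd

theorem exists_shiftedEntropy_bound :
    ∃ C, ∀ δ ∈ Icc (0 : ℝ) 1, ∀ y ∈ Icc (0 : ℝ) 1, |shiftedEntropy δ y| ≤ C := by
  obtain ⟨C, hC⟩ := (isCompact_Icc.prod isCompact_Icc :
    IsCompact (Icc (0 : ℝ) 1 ×ˢ Icc (0 : ℝ) 1)).exists_bound_of_continuousOn
    continuous_shiftedEntropy.continuousOn
  exact ⟨C, fun δ hδ y hy => hC (δ, y) ⟨hδ, hy⟩⟩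

variable {μ : Measure Space} [IsFiniteMeasure μ] {f : Space → ℝ}

theorem integrable_shiftedEntropy (hf : AEStronglyMeasurable f μ)
    (h01 : ∀ᵐ x ∂μ, f x ∈ Icc (0 : ℝ) 1) {δ : ℝ} (hδ : δ ∈ Icc (0 : ℝ) 1) :
    Integrable (fun x => shiftedEntropy δ (f x)) μ := by
  obtain ⟨C, hC⟩ := exists_shiftedEntropy_bound
  refine Integrable.of_bound (C := C) ((continuous_shiftedEntropy.comp
    (Continuous.prodMk_right δ)).comp_aestronglyMeasurable hf) ?_
  filter_upwards [h01] with x hx using hC δ hδ _ hx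

/-- `y ln y` is continuous up to `0`, so `shiftedEntropy` is jointly continuous, hence bounded for
`δ` and `y` in `[0, 1]`, and dominated convergence applies. -/
theorem tendsto_integral_shiftedEntropy (hf : AEStronglyMeasurable f μ)
    (h01 : ∀ᵐ x ∂μ, f x ∈ Icc (0 : ℝ) 1) :
    Tendsto (fun δ => ∫ x, shiftedEntropy δ (f x) ∂μ) (𝓝[>] 0)
      (𝓝 (∫ x, entropyDensity (f x) ∂μ)) := by
  obtain ⟨C, hC⟩ := exists_shiftedEntropy_bound
  have hev : ∀ᶠ δ in 𝓝[>] (0 : ℝ), δ ∈ Icc (0 : ℝ) 1 :=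
    mem_of_superset (Ioo_mem_nhdsGT one_pos) Ioo_subset_Icc_self
  refine tendsto_integral_filter_of_dominated_convergence (fun _ => C) ?_ ?_
    (integrable_const C) ?_
  · filter_upwards [hev] with δ hδ using (integrable_shiftedEntropy hf h01 hδ).1
  · filter_upwards [hev] with δ hδ
    filter_upwards [h01] with x hx using hC δ hδ _ hx
  · refine Eventually.of_forall fun x => ?_
    rw [entropyDensity_eq]
    have := (continuous_shiftedEntropy.comp (Continuous.prodMk_left (f x))).tendsto 0
    exact this.mono_left nhdsWithin_le_nhds

/-- The regularised entropy differs from the shifted one by `(y + δ) ln δ`, which diverges in the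
limit. Summed over the species, this term depends only on `δ`, `n` and the total mass of `μ`, and so
cancels between two times. -/
theorem sum_integral_regEntropy {n : ℕ} {f : Fin n → Space → ℝ}
    (hf : ∀ i, AEStronglyMeasurable (f i) μ) (h01 : ∀ i, ∀ᵐ x ∂μ, f i x ∈ Icc (0 : ℝ) 1)
    (h1 : ∀ᵐ x ∂μ, ∑ i, f i x = 1) {δ : ℝ} (hδ : δ ∈ Ioc (0 : ℝ) 1) :
    ∑ i, ∫ x, regEntropy δ (f i x) ∂μ =
      ∑ i, ∫ x, shiftedEntropy δ (f i x) ∂μ - Real.log δ * (1 + n * δ) * μ.real univ := by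
  have e : ∀ i, ∫ x, regEntropy δ (f i x) ∂μ =
      ∫ x, shiftedEntropy δ (f i x) ∂μ - Real.log δ * ∫ x, (f i x + δ) ∂μ := by
    intro i
    have hi : Integrable (fun x => f i x + δ) μ := by
      refine Integrable.add (Integrable.of_bound (C := 1) (hf i) ?_) (integrable_const δ)
      filter_upwards [h01 i] with x hx
      rw [Real.norm_eq_abs, abs_of_nonneg hx.1]
      exact hx.2
    rw [← integral_const_mul, ← integral_sub
      (integrable_shiftedEntropy (hf i) (h01 i) ⟨hδ.1.le, hδ.2⟩) (hi.const_mul _)]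
    refine integral_congr_ae ?_
    filter_upwards [h01 i] with x hx
    have hpos : 0 < f i x + δ := add_pos_of_nonneg_of_pos hx.1 hδ.1
    have : 1 + f i x / δ = (f i x + δ) / δ := by
      have := hδ.1.ne'
      field_simp
      ring
    simp only [regEntropy, shiftedEntropy]
    rw [this, Real.log_div hpos.ne' hδ.1.ne']
    ring
  have hs : ∑ i, ∫ x, (f i x + δ) ∂μ = (1 + n * δ) * μ.real univ := by
    rw [← integral_finsetSum]
    · have : ∫ x, ∑ i, (f i x + δ) ∂μ = ∫ _, (1 + n * δ) ∂μ := by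
        refine integral_congr_ae ?_
        filter_upwards [h1] with x hx
        simp [Finset.sum_add_distrib, hx]
      rw [this]
      simp [mul_comm]
    · intro i _
      refine Integrable.add (Integrable.of_bound (C := 1) (hf i) ?_) (integrable_const δ)
      filter_upwards [h01 i] with x hx
      rw [Real.norm_eq_abs, abs_of_nonneg hx.1]
      exact hx.2
  simp only [e]
  rw [Finset.sum_sub_distrib, ← Finset.mul_sum, hs]
  ring

/-- The weights `c / (c + δ)` lie in `[0, 1]` and increase to the indicator of `c > 0`. This is how
vacuum drops out of the entropy production. -/
theorem tendsto_integral_div_add {α : Type*} [MeasurableSpace α] {μ : Measure α} {c f : α → ℝ}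
    (hc : AEStronglyMeasurable c μ) (hf : Integrable f μ) (h0 : ∀ᵐ x ∂μ, 0 ≤ c x) :
    Integrable (fun x => if 0 < c x then f x else 0) μ ∧
    (∀ δ > 0, Integrable (fun x => c x / (c x + δ) * f x) μ) ∧
    Tendsto (fun δ => ∫ x, c x / (c x + δ) * f x ∂μ) (𝓝[>] 0)
      (𝓝 (∫ x, if 0 < c x then f x else 0 ∂μ)) := by
  have hm : ∀ δ, AEStronglyMeasurable (fun x => c x / (c x + δ) * f x) μ := fun δ =>
    ((hc.aemeasurable.div (hc.aemeasurable.add_const δ)).mul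
      hf.1.aemeasurable).aestronglyMeasurable
  have hb : ∀ δ > 0, ∀ᵐ x ∂μ, ‖c x / (c x + δ) * f x‖ ≤ ‖f x‖ := by
    intro δ hδ
    filter_upwards [h0] with x hx
    rw [norm_mul, Real.norm_of_nonneg (div_nonneg hx (by linarith))]
    exact mul_le_of_le_one_left (norm_nonneg _) ((div_le_one (by linarith)).2 (by linarith))
  have hlim : ∀ᵐ x ∂μ, Tendsto (fun δ => c x / (c x + δ) * f x) (𝓝[>] 0)
      (𝓝 (if 0 < c x then f x else 0)) := by
    filter_upwards [h0] with x hx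
    split_ifs with h
    · have h1 : Tendsto (fun δ => c x / (c x + δ) * f x) (𝓝 0) (𝓝 (c x / (c x + 0) * f x)) :=
        (tendsto_const_nhds.div (tendsto_const_nhds.add tendsto_id)
          (by simpa using h.ne')).mul_const _
      rw [add_zero, div_self h.ne', one_mul] at h1
      exact h1.mono_left nhdsWithin_le_nhds
    · have : c x = 0 := le_antisymm (not_lt.1 h) hx
      simp [this]
  refine ⟨?_, fun δ hδ => hf.mono (hm δ) (hb δ hδ), ?_⟩
  · refine hf.mono (aestronglyMeasurable_of_tendsto_ae (𝓝[>] (0 : ℝ)) hm hlim)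
      (Eventually.of_forall fun x => ?_)
    split_ifs
    · exact le_rfl
    · simp
  · refine tendsto_integral_filter_of_dominated_convergence (fun x => ‖f x‖)
      (Eventually.of_forall hm) ?_ hf.norm hlim
    filter_upwards [self_mem_nhdsWithin] with δ hδ using hb δ hδ

end Limit

/-! ### Entropy balance for weak solutions. -/

section WeakSolution

variable {n : ℕ} {Ω : Set Space} {T : ℝ} {D : Fin n → Fin n → ℝ} {c₀ : Fin n → Space → ℝ}
  {c : Fin n → ℝ → Space → ℝ} {m : Fin n → ℝ → Space → Space}

/-- Coercivity of the friction matrix bounds `m` pointwise by the gradients of the `√c_j`, with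
constant `2 / κ`. -/
theorem IsWeakSolution.memLp_velocity (hD : IsDiffusivity D) (hc : IsWeakSolution Ω T D c₀ c m)
    (i : Fin n) : MemLp (fun p : ℝ × Space => m i p.1 p.2) 2 (spaceTime Ω T) := by
  obtain ⟨G, hG, hsys⟩ := hc.friction
  obtain ⟨κ, hκ, hκD⟩ := exists_frictionCoeff_lower_bound hD
  have hS : MemLp (fun p : ℝ × Space => ∑ j, ‖G j p.1 p.2‖) 2 (spaceTime Ω T) :=
    memLp_finsetSum _ fun j _ => (hG j).memLp_gradient.norm
  refine hS.of_le_mul (c := 2 / κ) (hc.measurable_m i) ?_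
  filter_upwards [hsys, eventually_all.2 hc.nonneg, hc.sum_eq_one] with p h1 h2 h3
  have h4 := sum_norm_sq_le_of_friction hD hκ hκD h2 h3 h1.1 h1.2
  have h5 : ‖m i p.1 p.2‖ ^ 2 ≤ ∑ i, ‖m i p.1 p.2‖ ^ 2 :=
    Finset.single_le_sum (f := fun i => ‖m i p.1 p.2‖ ^ 2) (fun j _ => by positivity)
      (Finset.mem_univ i)
  have h6 : ∑ j, ‖G j p.1 p.2‖ ^ 2 ≤ (∑ j, ‖G j p.1 p.2‖) ^ 2 :=
    Finset.sum_sq_le_sq_sum_of_nonneg fun j _ => norm_nonneg _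
  have h7 : 0 ≤ ∑ j, ‖G j p.1 p.2‖ := Finset.sum_nonneg fun j _ => norm_nonneg _
  rw [Real.norm_of_nonneg h7]
  refine abs_le_of_sq_le_sq' ?_ (by positivity) |>.2
  calc _ ≤ _ := h5
    _ ≤ _ := h4
    _ ≤ 4 / κ ^ 2 * (∑ j, ‖G j p.1 p.2‖) ^ 2 := by gcongr
    _ = _ := by ring

/-- The flux `√cᵢ mᵢ`, extended by zero to all times. -/
noncomputable def flux (T : ℝ) (a : ℝ → Space → ℝ) (m : ℝ → Space → Space)
    (p : ℝ × Space) : Space :=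
  (Ioo 0 T).indicator (fun t => √(a t p.2) • m t p.2) p.1

theorem ae_time_mem (Ω : Set Space) (T : ℝ) : ∀ᵐ p ∂(spaceTime Ω T), p.1 ∈ Ioo 0 T :=
  Measure.quasiMeasurePreserving_fst.ae (ae_restrict_mem measurableSet_Ioo)

theorem IsWeakSolution.le_one (hc : IsWeakSolution Ω T D c₀ c m) (i : Fin n) :
    ∀ᵐ p ∂(spaceTime Ω T), c i p.1 p.2 ≤ 1 := by
  filter_upwards [eventually_all.2 hc.nonneg, hc.sum_eq_one] with p h1 h2
  rw [← h2]
  exact Finset.single_le_sum (f := fun i => c i p.1 p.2) (fun j _ => h1 j) (Finset.mem_univ i)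

theorem IsWeakSolution.isConserved (hT : 0 < T) (hD : IsDiffusivity D)
    (hc : IsWeakSolution Ω T D c₀ c m) (i : Fin n) :
    IsConserved Ω T (fun t => c i (clamp T t)) (flux T (c i) (m i)) where
  memLp_flux := by
    have h1 : MemLp (fun p : ℝ × Space => √(c i p.1 p.2) • m i p.1 p.2) 2 (spaceTime Ω T) := by
      have hcm := (hc.bounded i).1
      refine (hc.memLp_velocity hD i).of_le
        ((Real.continuous_sqrt.comp_aestronglyMeasurable hcm).smul (hc.measurable_m i)) ?_
      filter_upwards [hc.le_one i] with p hp
      rw [norm_smul, Real.norm_of_nonneg (Real.sqrt_nonneg _)]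
      exact mul_le_of_le_one_left (norm_nonneg _) (Real.sqrt_le_one.2 hp)
    have e : flux T (c i) (m i) =
        (Ioo 0 T ×ˢ univ).indicator fun p => √(c i p.1 p.2) • m i p.1 p.2 := by
      ext1 p
      by_cases hp : p.1 ∈ Ioo 0 T
      · rw [flux, indicator_of_mem hp,
          indicator_of_mem (show p ∈ Ioo 0 T ×ˢ univ from ⟨hp, trivial⟩)]
      · rw [flux, indicator_of_notMem hp, indicator_of_notMem (fun h => hp h.1)]
    rw [e, memLp_indicator_iff_restrict (measurableSet_Ioo.prod MeasurableSet.univ),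
      ← Measure.prod_restrict, Measure.restrict_univ]
    exact h1
  flux_eq_zero t x ht := indicator_of_notMem ht _
  memLp t := (hc.continuousInL2 i _ (clamp_mem hT.le t)).1
  continuous t := by
    have h1 := (hc.continuousInL2 i _ (clamp_mem hT.le t)).2
    have h2 : Tendsto (clamp T) (𝓝 t) (𝓝[Icc 0 T] (clamp T t)) :=
      tendsto_nhdsWithin_iff.2 ⟨(continuous_clamp T).tendsto t,
        Eventually.of_forall fun s => clamp_mem hT.le s⟩
    exact h1.comp h2
  clamp_eq t := by rw [clamp_of_mem (clamp_mem hT.le t)]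
  weak_form φ hφ := by
    refine Eq.trans ?_ (hc.weak_form i φ hφ)
    congr 1
    · refine setIntegral_congr_fun measurableSet_Ioo fun t ht => ?_
      simp only [clamp_of_mem (Ioo_subset_Icc_self ht)]
    · refine setIntegral_congr_fun measurableSet_Ioo fun t ht => ?_
      simp only [flux, indicator_of_mem ht]

theorem IsWeakSolution.mem_Icc (hT : 0 < T) (hΩ : volume Ω ≠ ⊤) (hD : IsDiffusivity D)
    (hc : IsWeakSolution Ω T D c₀ c m) (t : ℝ) :
    (∀ i, ∀ᵐ x ∂(volume.restrict Ω), c i (clamp T t) x ∈ Icc (0 : ℝ) 1) ∧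
    ∀ᵐ x ∂(volume.restrict Ω), ∑ i, c i (clamp T t) x = 1 := by
  have hcons := hc.isConserved hT hD
  have h0 : ∀ i, ∀ᵐ x ∂(volume.restrict Ω), 0 ≤ c i (clamp T t) x := by
    intro i
    refine (hcons i).nonneg hT ?_ t
    filter_upwards [Measure.ae_ae_of_ae_prod (hc.nonneg i), ae_restrict_mem measurableSet_Ioo]
      with s hs hs'
    rwa [clamp_of_mem (Ioo_subset_Icc_self hs')]
  have h1 : ∀ᵐ x ∂(volume.restrict Ω), ∑ i, c i (clamp T t) x = 1 := by
    refine sum_eq_one_of_conserved hΩ hT hcons ?_ t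
    filter_upwards [Measure.ae_ae_of_ae_prod hc.sum_eq_one, ae_restrict_mem measurableSet_Ioo]
      with s hs hs'
    simpa only [clamp_of_mem (Ioo_subset_Icc_self hs')] using hs
  refine ⟨fun i => ?_, h1⟩
  filter_upwards [eventually_all.2 h0, h1] with x hx hx1
  refine ⟨hx i, ?_⟩
  rw [← hx1]
  exact Finset.single_le_sum (f := fun i => c i (clamp T t) x) (fun j _ => hx j) (Finset.mem_univ i)

theorem HasL2H1Gradient.clamp {v : ℝ → Space → ℝ} {G : ℝ → Space → Space}
    (h : HasL2H1Gradient Ω T v G) : HasL2H1Gradient Ω T (fun t => v (clamp T t)) G where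
  memLp := by
    refine (memLp_congr_ae ?_).1 h.memLp
    filter_upwards [ae_time_mem Ω T] with p hp
    rw [clamp_of_mem (Ioo_subset_Icc_self hp)]
  memLp_gradient := h.memLp_gradient
  ae_gradient := by
    filter_upwards [h.ae_gradient, ae_restrict_mem measurableSet_Ioo] with t ht ht'
    rwa [clamp_of_mem (Ioo_subset_Icc_self ht')]

theorem spaceTime_mono (Ω : Set Space) {b T : ℝ} (hb : b ≤ T) : spaceTime Ω b ≤ spaceTime Ω T := by
  simp only [spaceTime, Measure.prod_restrict]
  exact Measure.restrict_mono (prod_mono (Ioo_subset_Ioo_right hb) Subset.rfl) le_rfl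

/-- Balance of the regularised entropy of a component, in terms of the friction system. -/
theorem IsWeakSolution.regEntropy_balance (hΩ : IsBoundedSmoothDomain Ω) (hT : 0 < T)
    (hD : IsDiffusivity D) (hc : IsWeakSolution Ω T D c₀ c m) {i : Fin n} {G : ℝ → Space → Space}
    (hG : HasL2H1Gradient Ω T (fun t x => √(c i t x)) G) {δ : ℝ} (hδ : 0 < δ) {b : ℝ}
    (hb : b ∈ Ioc 0 T) :
    (∫ x in Ω, regEntropy δ (c i b x)) - ∫ x in Ω, regEntropy δ (c i 0 x) =
      ∫ p, c i p.1 p.2 / (c i p.1 p.2 + δ) * (2 * inner ℝ (m i p.1 p.2) (G p.1 p.2))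
        ∂(spaceTime Ω b) := by
  have hΩv : volume Ω ≠ ⊤ := hΩ.isBounded.measure_lt_top.ne
  have hle := spaceTime_mono Ω hb.2
  have hbal := (hc.isConserved hT hD i).regEntropy_balance hΩ hT
    (fun t => (hc.mem_Icc hT hΩv hD t).1 i) hG.clamp hδ hb
  rw [clamp_of_mem (Ioc_subset_Icc_self hb), clamp_of_mem ⟨le_rfl, hT.le⟩] at hbal
  rw [hbal]
  have hint : Integrable (fun p : ℝ × Space => 2 * inner ℝ (m i p.1 p.2) (G p.1 p.2))
      (spaceTime Ω b) :=
    ((integrable_inner (hc.memLp_velocity hD i) hG.memLp_gradient).mono_measure hle).const_mul 2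
  have hI := (tendsto_integral_div_add ((hc.bounded i).1.mono_measure hle) hint
    (ae_mono hle (hc.nonneg i))).2.1 δ hδ
  have hae : (fun p : ℝ × Space =>
      c i p.1 p.2 / (c i p.1 p.2 + δ) * (2 * inner ℝ (m i p.1 p.2) (G p.1 p.2)))
      =ᵐ[spaceTime Ω b] fun p => inner ℝ (flux T (c i) (m i) (p.1, p.2))
        (deriv (regPotential δ) √(c i (MaxwellStefan.clamp T p.1) p.2) • G p.1 p.2) := by
    -- The factor `√c` of the flux and the factor `2 √c / (c + δ)` from the derivative of the
    -- potential combine to `2 c / (c + δ)`.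
    filter_upwards [ae_mono hle (ae_time_mem Ω T), ae_mono hle (hc.nonneg i)] with p hp h0
    rw [clamp_of_mem (Ioo_subset_Icc_self hp), deriv_regPotential hδ, flux, indicator_of_mem hp,
      real_inner_smul_left, real_inner_smul_right, Real.sq_sqrt h0]
    have : √(c i p.1 p.2) * √(c i p.1 p.2) = c i p.1 p.2 := Real.mul_self_sqrt h0
    calc _ = c i p.1 p.2 * (2 / (c i p.1 p.2 + δ) * inner ℝ (m i p.1 p.2) (G p.1 p.2)) := by ring
      _ = _ := by
        nth_rewrite 1 [← this]
        ring
  rw [integral_congr_ae hae, spaceTime, integral_prod _ (hI.congr hae)]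

theorem IsWeakSolution.entropy_balance (hΩ : IsBoundedSmoothDomain Ω) (hT : 0 < T)
    (hD : IsDiffusivity D) (hc : IsWeakSolution Ω T D c₀ c m) {G : Fin n → ℝ → Space → Space}
    (hG : ∀ i, HasL2H1Gradient Ω T (fun t x => √(c i t x)) (G i)) {b : ℝ} (hb : b ∈ Ioc 0 T) :
    entropy Ω (fun i => c i b) - entropy Ω (fun i => c i 0) =
      ∑ i, ∫ p, (if 0 < c i p.1 p.2 then 2 * inner ℝ (m i p.1 p.2) (G i p.1 p.2) else 0)
        ∂(spaceTime Ω b) := by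
  have hΩv : volume Ω ≠ ⊤ := hΩ.isBounded.measure_lt_top.ne
  have hfin : IsFiniteMeasure (volume.restrict Ω) := isFiniteMeasure_restrict.2 hΩv
  have hle := spaceTime_mono Ω hb.2
  have h01 : ∀ t ∈ Icc 0 T, (∀ i, ∀ᵐ x ∂(volume.restrict Ω), c i t x ∈ Icc (0 : ℝ) 1) ∧
      ∀ᵐ x ∂(volume.restrict Ω), ∑ i, c i t x = 1 := fun t ht => by
    have := hc.mem_Icc hT hΩv hD t
    rwa [clamp_of_mem ht] at this
  have hm : ∀ t ∈ Icc 0 T, ∀ i, AEStronglyMeasurable (c i t) (volume.restrict Ω) :=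
    fun t ht i => (hc.continuousInL2 i t ht).1.1
  have hb' := Ioc_subset_Icc_self hb
  have h0' : (0 : ℝ) ∈ Icc 0 T := ⟨le_rfl, hT.le⟩
  have hlim : ∀ t ∈ Icc 0 T, Tendsto (fun δ => ∑ i, ∫ x in Ω, shiftedEntropy δ (c i t x)) (𝓝[>] 0)
      (𝓝 (entropy Ω fun i => c i t)) := fun t ht =>
    tendsto_finsetSum _ fun i _ => tendsto_integral_shiftedEntropy (hm t ht i) ((h01 t ht).1 i)
  have hint : ∀ i, Integrable (fun p : ℝ × Space => 2 * inner ℝ (m i p.1 p.2) (G i p.1 p.2))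
      (spaceTime Ω b) := fun i =>
    ((integrable_inner (hc.memLp_velocity hD i) (hG i).memLp_gradient).mono_measure hle).const_mul 2
  have hR := tendsto_finsetSum (f := fun i δ => ∫ p, c i p.1 p.2 / (c i p.1 p.2 + δ) *
      (2 * inner ℝ (m i p.1 p.2) (G i p.1 p.2)) ∂(spaceTime Ω b)) Finset.univ
    fun i _ => (tendsto_integral_div_add ((hc.bounded i).1.mono_measure hle) (hint i)
    (ae_mono hle (hc.nonneg i))).2.2
  refine tendsto_nhds_unique ((hlim b hb').sub (hlim 0 h0')) (hR.congr' ?_)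
  filter_upwards [Ioo_mem_nhdsGT one_pos] with δ hδ
  have hδ' := Ioo_subset_Ioc_self hδ
  have e1 := sum_integral_regEntropy (hm b hb') (h01 b hb').1 (h01 b hb').2 hδ'
  have e2 := sum_integral_regEntropy (hm 0 h0') (h01 0 h0').1 (h01 0 h0').2 hδ'
  have e3 : ∑ i, ∫ p, c i p.1 p.2 / (c i p.1 p.2 + δ) *
      (2 * inner ℝ (m i p.1 p.2) (G i p.1 p.2)) ∂(spaceTime Ω b) =
      ∑ i, ((∫ x in Ω, regEntropy δ (c i b x)) - ∫ x in Ω, regEntropy δ (c i 0 x)) :=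
    Finset.sum_congr rfl fun i _ => (hc.regEntropy_balance hΩ hT hD (hG i) hδ.1 hb).symm
  -- The terms containing `ln δ` are the same at times `b` and `0`, and cancel here.
  rw [e3, Finset.sum_sub_distrib, e1, e2]
  ring

theorem IsWeakSolution.aestronglyMeasurable_dissipation (hc : IsWeakSolution Ω T D c₀ c m)
    (i j : Fin n) : AEStronglyMeasurable (fun p : ℝ × Space => dissipation D c m i j p.1 p.2)
      (spaceTime Ω T) := by
  have hcm := fun i => (hc.bounded i).1
  have hv : ∀ i, AEStronglyMeasurable (fun p : ℝ × Space =>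
      velocity (c i p.1 p.2) (m i p.1 p.2)) (spaceTime Ω T) := fun i =>
    (Real.continuous_sqrt.comp_aestronglyMeasurable
      (hcm i)).aemeasurable.inv.aestronglyMeasurable.smul (hc.measurable_m i)
  unfold dissipation
  exact (((hcm i).mul (hcm j)).mul aestronglyMeasurable_const).mul (((hv i).sub (hv j)).norm.pow 2)

end WeakSolution

end MaxwellStefan

/-! ### The entropy equality. -/

open MaxwellStefan in
theorem theorem1 {n : ℕ} (Ω : Set MaxwellStefan.Space)
    (hΩ : MaxwellStefan.IsBoundedSmoothDomain Ω) (T : ℝ) (hT : 0 < T)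
    (D : Fin n → Fin n → ℝ) (hD : MaxwellStefan.IsDiffusivity D)
    (c₀ : Fin n → MaxwellStefan.Space → ℝ)
    (hc₀_nonneg : ∀ i, ∀ᵐ x ∂(volume.restrict Ω), 0 ≤ c₀ i x)
    (hc₀_sum : ∀ᵐ x ∂(volume.restrict Ω), ∑ i, c₀ i x = 1)
    (c : Fin n → ℝ → MaxwellStefan.Space → ℝ)
    (m : Fin n → ℝ → MaxwellStefan.Space → MaxwellStefan.Space)
    (hc : MaxwellStefan.IsWeakSolution Ω T D c₀ c m) :
    (∀ i, IntegrableOn (fun x => MaxwellStefan.entropyDensity (c₀ i x)) Ω) ∧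
    ∀ t ∈ Ioc 0 T,
      (∀ i, IntegrableOn (fun x => MaxwellStefan.entropyDensity (c i t x)) Ω) ∧
      (∀ i j, IntegrableOn
        (fun p : ℝ × MaxwellStefan.Space => MaxwellStefan.dissipation D c m i j p.1 p.2)
        (Ioo 0 t ×ˢ Ω)) ∧
      MaxwellStefan.entropy Ω (fun i => c i t) +
        1 / 2 * ∑ i, ∑ j, ∫ s in Ioo 0 t, ∫ x in Ω, MaxwellStefan.dissipation D c m i j s x
      = MaxwellStefan.entropy Ω c₀ := by
  have hΩv : volume Ω ≠ ⊤ := hΩ.isBounded.measure_lt_top.ne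
  have hfin : IsFiniteMeasure (volume.restrict Ω) := isFiniteMeasure_restrict.2 hΩv
  have hent : ∀ t ∈ Icc 0 T, ∀ i,
      IntegrableOn (fun x => MaxwellStefan.entropyDensity (c i t x)) Ω := by
    intro t ht i
    have h1 := (hc.mem_Icc hT hΩv hD t).1 i
    rw [clamp_of_mem ht] at h1
    simp only [entropyDensity_eq]
    exact integrable_shiftedEntropy (hc.continuousInL2 i t ht).1.1 h1 ⟨le_rfl, zero_le_one⟩
  have h0 : ∀ i, (fun x => entropyDensity (c i 0 x)) =ᵐ[volume.restrict Ω]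
      fun x => entropyDensity (c₀ i x) := fun i => by
    filter_upwards [hc.initial i] with x hx
    rw [hx]
  refine ⟨fun i => (hent 0 ⟨le_rfl, hT.le⟩ i).congr (h0 i), fun t ht => ?_⟩
  have hle := spaceTime_mono Ω ht.2
  obtain ⟨G, hG, hsys⟩ := hc.friction
  have hbal := hc.entropy_balance hΩ hT hD hG ht
  have hf : ∀ i, Integrable (fun p : ℝ × Space =>
      if 0 < c i p.1 p.2 then 2 * inner ℝ (m i p.1 p.2) (G i p.1 p.2) else 0) (spaceTime Ω t) :=
    fun i => (tendsto_integral_div_add ((hc.bounded i).1.mono_measure hle)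
      (((integrable_inner (hc.memLp_velocity hD i) (hG i).memLp_gradient).mono_measure
        hle).const_mul 2) (ae_mono hle (hc.nonneg i))).1
  have hpt : ∀ᵐ p ∂(spaceTime Ω t), (∀ i, 0 ≤ c i p.1 p.2) ∧
      ∑ i, (if 0 < c i p.1 p.2 then 2 * inner ℝ (m i p.1 p.2) (G i p.1 p.2) else 0) =
      -(1 / 2 * ∑ i, ∑ j, dissipation D c m i j p.1 p.2) := by
    filter_upwards [ae_mono hle hsys, ae_mono hle (eventually_all.2 hc.nonneg)] with p h1 h2
    exact ⟨h2, sum_inner_eq_dissipation hD h2 h1.1⟩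
  -- The densities are nonnegative, so each is at most their total, which by `hpt` equals `-2` times
  -- an integrable function.
  have hdiss : ∀ i j, Integrable (fun p : ℝ × Space => dissipation D c m i j p.1 p.2)
      (spaceTime Ω t) := by
    intro i j
    refine ((integrable_finsetSum Finset.univ fun i _ => hf i).const_mul (-2)).mono'
      ((hc.aestronglyMeasurable_dissipation i j).mono_measure hle) ?_
    filter_upwards [hpt] with p hp
    have hnn := fun i j => dissipation_nonneg hD (m := m) hp.1 i j
    rw [hp.2, Real.norm_of_nonneg (hnn i j)]
    have h1 : dissipation D c m i j p.1 p.2 ≤ ∑ j, dissipation D c m i j p.1 p.2 :=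
      Finset.single_le_sum (f := fun j => dissipation D c m i j p.1 p.2) (fun j _ => hnn i j)
        (Finset.mem_univ j)
    have h2 : ∑ j, dissipation D c m i j p.1 p.2 ≤ ∑ i, ∑ j, dissipation D c m i j p.1 p.2 :=
      Finset.single_le_sum (f := fun i => ∑ j, dissipation D c m i j p.1 p.2)
        (fun i _ => Finset.sum_nonneg fun j _ => hnn i j) (Finset.mem_univ i)
    linarith
  refine ⟨hent t (Ioc_subset_Icc_self ht), fun i j => ?_, ?_⟩
  · rw [IntegrableOn, Measure.volume_eq_prod, ← Measure.prod_restrict]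
    exact hdiss i j
  · have e0 : entropy Ω (fun i => c i 0) = entropy Ω c₀ :=
      Finset.sum_congr rfl fun i _ => integral_congr_ae (h0 i)
    have e1 : ∑ i, ∑ j, ∫ s in Ioo 0 t, ∫ x in Ω, dissipation D c m i j s x =
        ∫ p, ∑ i, ∑ j, dissipation D c m i j p.1 p.2 ∂(spaceTime Ω t) := by
      rw [integral_finsetSum _ fun i _ => integrable_finsetSum _ fun j _ => hdiss i j]
      refine Finset.sum_congr rfl fun i _ => ?_
      rw [integral_finsetSum _ fun j _ => hdiss i j]
      refine Finset.sum_congr rfl fun j _ => ?_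
      exact (integral_prod _ (hdiss i j)).symm
    rw [← integral_finsetSum _ fun i _ => hf i, integral_congr_ae (hpt.mono fun p hp => hp.2),
      integral_neg, integral_const_mul, ← e1] at hbal
    linarith
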